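/- There are an absolute constant $c\in\mathbb N$ and, for all $\alpha,\beta,\kappa>0$, a constant $C=C(\alpha,\beta,\kappa)>0$ such that the following holds for all $d,k\in\mathbb N$, $\gamma>0$, $\varepsilon\in(0,1)$ and real $s\ge 1$. Let $\mathcal D$ be a probability distribution on $\mathbb R^d$ such that for every unit vector $w\in\mathbb R^d$ $$\Pr_{x\sim\mathcal D}[|w\cdot x|\ge r]\le \alpha\,e^{-\beta r^{1+\gamma}}\ \ (r\ge 0)\qquad\text{and}\qquad \Pr_{x\sim\mathcal D}[|w\cdot x-t|\le r]\le\kappa r\ \ (t\in\mathbb R,\ r\ge0)$$ ($\mathcal D$ is $\gamma$-strictly subexponential and anticoncentrated in every direction). Let $\mathcal F$ be the class of all functions $f(x)=G(\mathrm{sign}(w_1\cdot x-t_1),\dots,\mathrm{sign}(w_k\cdot x-t_k))$ with unit vectors $w_i\in\mathbb R^d$, $t_i\in\mathbb R$ and an arbitrary $G:\{\pm1\}^k\to\{\pm1\}$, where $\mathrm{sign}(0)=1$. Let the $(\varepsilon,s)$-sandwiching degree of $f$ with respect to $\mathcal D$ be the least $\ell$ for which there are real polynomials $p_{\rm down},p_{\rm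 up}$ on $\mathbb R^d$ of total degree at most $\ell$ with $p_{\rm down}(x)\le f(x)\le p_{\rm up}(x)$ for all $x\in\mathbb R^d$ and $\left(\mathbb E_{x\sim\mathcal D}|p_{\rm up}(x)-p_{\rm down}(x)|^s\right)^{1/s}\le\varepsilon$ (and $\infty$ if there are none), and let that of $\mathcal F$ be the supremum $\ell(\varepsilon,s)$ over $f\in\mathcal F$. Then $$\ell(\varepsilon,s)\le\Bigl(C\,X\,(\log X)^c\Bigr)^{1+1/\gamma},\qquad X=\frac{k^{5/2}s}{(\varepsilon/2)^{s+1}},$$ that is, $\ell(\varepsilon,s)\le\widetilde O\Bigl(\frac{k^{5/2}s}{(\varepsilon/2)^{s+1}}\Bigr)^{1+1/\gamma}$. (For $k=0$ the right-hand side is read as $0$.) -/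

import Mathlib

open MeasureTheory
open scoped ENNReal

/-- A probability distribution `D` on `ℝ^d` is `γ`-strictly subexponential with parameters `a, b` if
`Pr[|⟨w, x⟩| ≥ r] ≤ a * exp (-b * r ^ (1 + γ))` for every unit vector `w` and every `r ≥ 0`. -/
def IsStrictlySubexponential {d : ℕ} (D : Measure (EuclideanSpace ℝ (Fin d))) (γ a b : ℝ) : Prop :=
  ∀ w : EuclideanSpace ℝ (Fin d), ‖w‖ = 1 → ∀ r : ℝ, 0 ≤ r →
    D {x | r ≤ |inner ℝ w x|} ≤ ENNReal.ofReal (a * Real.exp (-b * r ^ (1 + γ)))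

/-- A probability distribution `D` on `ℝ^d` is `κ`-anticoncentrated in every direction if
`Pr[|⟨w, x⟩ - t| ≤ r] ≤ κ * r` for every unit vector `w`, every real `t` and every `r ≥ 0`. -/
def IsAnticoncentrated {d : ℕ} (D : Measure (EuclideanSpace ℝ (Fin d))) (κ : ℝ) : Prop :=
  ∀ w : EuclideanSpace ℝ (Fin d), ‖w‖ = 1 → ∀ t r : ℝ, 0 ≤ r →
    D {x | |inner ℝ w x - t| ≤ r} ≤ ENNReal.ofReal (κ * r)

/-- A concept on `ℝ^d` is a function with values in `{-1, 1}`, which is the type `ℤˣ`. -/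
abbrev BooleanConcept (d : ℕ) : Type := EuclideanSpace ℝ (Fin d) → ℤˣ

/-- The halfspace `x ↦ sign (⟨w, x⟩ - t)`, with the convention `sign 0 = 1`. -/
noncomputable def halfspace {d : ℕ} (w : EuclideanSpace ℝ (Fin d)) (t : ℝ) : BooleanConcept d :=
  fun x => if t ≤ inner ℝ w x then 1 else -1

/-- The class of arbitrary Boolean functions `G : {-1, 1}^k → {-1, 1}` of `k` halfspaces over
`ℝ^d`; the halfspaces are given by unit normals `w i` and thresholds `t i`. -/
def functionsOfHalfspaces (d k : ℕ) : Set (BooleanConcept d) :=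
  {f | ∃ (w : Fin k → EuclideanSpace ℝ (Fin d)) (t : Fin k → ℝ) (G : (Fin k → ℤˣ) → ℤˣ),
    (∀ i, ‖w i‖ = 1) ∧ ∀ x, f x = G (fun i => halfspace (w i) (t i) x)}

/-- There are polynomials of total degree at most `l` that lie pointwise below and above `f`
on all of `ℝ^d`, and whose difference has `L^s(D)`-norm at most `ε`. -/
def HasSandwichingPolynomials {d : ℕ} (f : BooleanConcept d) (D : Measure (EuclideanSpace ℝ (Fin d)))
    (ε s : ℝ) (l : ℕ) : Prop :=
  ∃ pUp pDown : MvPolynomial (Fin d) ℝ,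
    pUp.totalDegree ≤ l ∧ pDown.totalDegree ≤ l ∧
    (∀ x : EuclideanSpace ℝ (Fin d),
      MvPolynomial.eval (fun i => x i) pDown ≤ ((f x : ℤ) : ℝ) ∧
      ((f x : ℤ) : ℝ) ≤ MvPolynomial.eval (fun i => x i) pUp) ∧
    eLpNorm (fun x : EuclideanSpace ℝ (Fin d) =>
        MvPolynomial.eval (fun i => x i) pUp - MvPolynomial.eval (fun i => x i) pDown)
      (ENNReal.ofReal s) D ≤ ENNReal.ofReal ε

/-- The `(ε, s)`-sandwiching degree of a concept: the least degree of a pair of sandwiching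
polynomials, and `⊤` if there is no such pair. -/
noncomputable def sandwichingDegree {d : ℕ} (f : BooleanConcept d)
    (D : Measure (EuclideanSpace ℝ (Fin d))) (ε s : ℝ) : ℕ∞ :=
  ⨅ (l : ℕ) (_ : HasSandwichingPolynomials f D ε s l), (l : ℕ∞)

/-- The `(ε, s)`-sandwiching degree of a class of concepts: the supremum over its elements. -/
noncomputable def classSandwichingDegree {d : ℕ} (F : Set (BooleanConcept d))
    (D : Measure (EuclideanSpace ℝ (Fin d))) (ε s : ℝ) : ℕ∞ :=
  ⨆ f ∈ F, sandwichingDegree f D ε s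

/-- The quantity `k^{5/2} s / (ε/2)^{s+1}`. -/
noncomputable def halfspaceRate (k : ℕ) (ε s : ℝ) : ℝ :=
  (k : ℝ) ^ (5 / 2 : ℝ) * s / (ε / 2) ^ (s + 1)

/-!
For a single threshold `t` there are polynomials in one variable which, on `[-R, R]`, form the
probabilities of a noisy verdict about the sign of `y - t`, with the option to abstain: the wrong
verdict has probability at most `η`, and so has abstention once `|y - t| > ρ`. They come from
translates of a monotone polynomial step, the normalized antiderivative of the Jackson type kernel
`(T_M(y) / y) ^ 4` with `M` of order `(R / ρ) * η ^ (-1/2)` (`exists_step_polynomial`,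
`exists_threshold_polynomials`).

Given `k` halfspaces, ask for independent verdicts and take the expectation of the largest value of
`G` on the sign vectors compatible with them. This is a polynomial in the `k` projections. On the
cube `[-R, R]^k` it is at least `f - 2 k η`, because the wrong verdicts are unlikely, and it exceeds
the corresponding lower expectation by at most `2`, and by at most `2 k η` unless some projection
is `ρ`-close to its threshold (`le_maxCompletionMean`, `maxCompletionMean_add_le`). Outside the cube
the polynomials grow at most like `(15 |y| / R) ^ N`, where `N` bounds their degree, so adding
`∑ i, (15 y_i / R) ^ (2 N)` restores the inequalities on the whole space
(`exists_pointwise_sandwich`). This sum is small in `L^s` when `R` is of order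
`s * N ^ (1 / (1 + γ))`, by the tail bound (`eLpNorm_pow_le`).

Anticoncentration bounds the probability of the exceptional event by `k κ ρ`, so `ρ` is taken of
order `(ε / 2) ^ s / (k κ)`, and `η` of order `ε / (k s)`. That the gap is at most `2` and not
merely bounded is what gives the base `ε / 2` of the power (`eLpNorm_le_of_le_indicator_add`).
The degree `k * M` is then of order `k ^ (5/2) * (2 / ε) ^ (s + 1) * N ^ (1 / (1 + γ))`
up to powers of `s`, which the logarithm absorbs. Requiring it to be at most `N` leads to the
exponent `1 + 1 / γ` (`exists_degree`).
-/

/-! ### Antiderivatives and Chebyshev polynomials -/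

open Polynomial in
lemma exists_antiderivative (p : ℝ[X]) :
    ∃ P : ℝ[X], derivative P = p ∧ P.natDegree ≤ p.natDegree + 1 := by
  refine ⟨∑ i ∈ Finset.range (p.natDegree + 1), C (p.coeff i / (i + 1)) * X ^ (i + 1), ?_, ?_⟩
  · conv_rhs => rw [p.as_sum_range_C_mul_X_pow]
    rw [derivative_sum]
    refine Finset.sum_congr rfl fun i _ => ?_
    rw [derivative_C_mul_X_pow]
    have : ((i : ℝ) + 1) ≠ 0 := by positivity
    simp only [Nat.add_sub_cancel]
    congr 2
    push_cast
    field_simp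
  · refine natDegree_sum_le_of_forall_le _ _ fun i hi => ?_
    refine (natDegree_C_mul_X_pow_le _ _).trans ?_
    have := Finset.mem_range.1 hi
    omega

open Polynomial in
lemma abs_eval_chebyshevT_le {x : ℝ} (hx : 1 ≤ |x|) (n : ℕ) :
    |(Chebyshev.T ℝ n).eval x| ≤ (3 * |x|) ^ n := by
  induction n using Nat.twoStepInduction with
  | zero => simp
  | one => simp; linarith
  | more n h0 h1 =>
    have e : (Chebyshev.T ℝ ((n + 2 : ℕ) : ℤ)).eval x =
        2 * x * (Chebyshev.T ℝ ((n + 1 : ℕ) : ℤ)).eval x - (Chebyshev.T ℝ (n : ℤ)).eval x := by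
      push_cast
      rw [Chebyshev.T_add_two]
      simp
    rw [e]
    refine (abs_sub _ _).trans ?_
    rw [abs_mul, abs_mul, abs_two]
    have h3 : 0 ≤ (3 * |x|) ^ n := by positivity
    have : 2 * |x| * |(Chebyshev.T ℝ ((n + 1 : ℕ) : ℤ)).eval x| ≤ 2 * |x| * (3 * |x|) ^ (n + 1) := by
      gcongr
    have h4 : (3 * |x|) ^ n * 1 ≤ (3 * |x|) ^ n * |x| ^ 2 := by
      gcongr; nlinarith
    calc _ ≤ 2 * |x| * (3 * |x|) ^ (n + 1) + (3 * |x|) ^ n := add_le_add this h0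
      _ ≤ (3 * |x|) ^ (n + 2) := by
        have e1 : (3 * |x|) ^ (n + 1) = (3 * |x|) ^ n * (3 * |x|) := pow_succ _ _
        have e2 : (3 * |x|) ^ (n + 2) = (3 * |x|) ^ n * (9 * |x| ^ 2) := by ring
        rw [e1, e2]
        nlinarith [mul_nonneg h3 (sq_nonneg |x|)]

open Polynomial in
/-- Near the origin a Chebyshev polynomial of degree `4 j + 1` grows linearly, with slope comparable
to its degree. -/
lemma le_abs_eval_chebyshevT (j : ℕ) {x : ℝ} (hx : (4 * j + 1 : ℝ) * |x| ≤ 1 / 2) :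
    (4 * j + 1 : ℝ) * |x| / 2 ≤ |(Chebyshev.T ℝ (4 * j + 1 : ℕ)).eval x| := by
  -- With `y = sin φ` one has `T (4 j + 1) y = sin ((4 j + 1) φ)`, and Jordan's inequality applies.
  have main : ∀ y : ℝ, 0 ≤ y → (4 * j + 1 : ℝ) * y ≤ 1 / 2 →
      (4 * j + 1 : ℝ) * y / 2 ≤ (Chebyshev.T ℝ (4 * j + 1 : ℕ)).eval y := by
    intro y hy h
    have hj : (0 : ℝ) ≤ j := Nat.cast_nonneg j
    have hy1 : y ≤ 1 := by nlinarith
    set φ := Real.arcsin y with hφ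
    have hsin : Real.sin φ = y := Real.sin_arcsin (by linarith) hy1
    have hφ0 : 0 ≤ φ := Real.arcsin_nonneg.2 hy
    have hφ1 : φ ≤ Real.pi / 2 := Real.arcsin_le_pi_div_two y
    have hyφ : y ≤ φ := hsin ▸ Real.sin_le hφ0
    have hφy : 2 / Real.pi * φ ≤ y := hsin ▸ Real.mul_le_sin hφ0 hφ1
    have hpi := Real.pi_gt_three
    have hpi4 := Real.pi_le_four
    have hφy' : φ ≤ Real.pi / 2 * y := by
      rw [div_mul_eq_mul_div, div_le_iff₀ Real.pi_pos] at hφy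
      linarith
    have hM : (4 * j + 1 : ℝ) * φ ≤ Real.pi / 2 := by
      nlinarith [mul_le_mul_of_nonneg_left hφy' (by positivity : (0 : ℝ) ≤ 4 * j + 1)]
    have hT : (Chebyshev.T ℝ (4 * j + 1 : ℕ)).eval y = Real.sin ((4 * j + 1 : ℝ) * φ) := by
      rw [← hsin, ← Real.cos_pi_div_two_sub, Chebyshev.T_real_cos, ← Real.cos_pi_div_two_sub,
        ← Real.cos_add_nat_mul_two_pi (Real.pi / 2 - _) j]
      congr 1
      push_cast
      ring
    rw [hT]
    refine le_trans ?_ (Real.mul_le_sin (by positivity) hM)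
    rw [div_mul_eq_mul_div, le_div_iff₀ Real.pi_pos]
    have : (4 * j + 1 : ℝ) * y ≤ (4 * j + 1 : ℝ) * φ := by gcongr
    have h0 : 0 ≤ (4 * j + 1 : ℝ) * y := by positivity
    nlinarith
  have hodd : |(Chebyshev.T ℝ (4 * j + 1 : ℕ)).eval x| =
      abs ((Chebyshev.T ℝ (4 * j + 1 : ℕ)).eval |x|) := by
    rcases abs_choice x with h | h
    · rw [h]
    · rw [h, Chebyshev.T_eval_neg, abs_mul]
      have : Odd ((4 * j + 1 : ℕ) : ℤ) := ⟨2 * j, by push_cast; ring⟩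
      rw [Int.negOnePow_odd _ this]
      simp
  rw [hodd]
  exact (main |x| (abs_nonneg x) hx).trans (le_abs_self _)

/-! ### A monotone polynomial step -/

open Polynomial in
lemma eval_sub_eval_le {P : ℝ[X]} {u v c : ℝ} (huv : u ≤ v)
    (h : ∀ x ∈ Set.Icc u v, (derivative P).eval x ≤ c) : P.eval v - P.eval u ≤ c * (v - u) := by
  refine (convex_Icc u v).image_sub_le_mul_sub_of_deriv_le P.continuous.continuousOn
    P.differentiable.differentiableOn (fun x hx => ?_) u (Set.left_mem_Icc.2 huv) v
    (Set.right_mem_Icc.2 huv) huv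
  rw [Polynomial.deriv]
  exact h x (interior_subset hx)

open Polynomial in
lemma le_eval_sub_eval {P : ℝ[X]} {u v c : ℝ} (huv : u ≤ v)
    (h : ∀ x ∈ Set.Icc u v, c ≤ (derivative P).eval x) : c * (v - u) ≤ P.eval v - P.eval u := by
  have := eval_sub_eval_le (P := -P) (c := -c) huv fun x hx => by
    simpa using h x hx
  simp only [eval_neg] at this
  linarith

open Polynomial in
/-- The tail of an antiderivative of a kernel that decays like `x ^ (-4)`. -/
lemma eval_one_sub_eval_le {P : ℝ[X]} {δ : ℝ} (hδ : 0 < δ) (hδ1 : δ ≤ 1)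
    (h : ∀ x ∈ Set.Icc δ 1, (derivative P).eval x ≤ 1 / x ^ 4) :
    P.eval 1 - P.eval δ ≤ 1 / (3 * δ ^ 3) := by
  have key : AntitoneOn (fun x : ℝ => P.eval x + (1 / 3) * (x ^ 3)⁻¹) (Set.Icc δ 1) := by
    have hd : ∀ x ∈ Set.Icc δ 1, HasDerivAt (fun x : ℝ => P.eval x + (1 / 3) * (x ^ 3)⁻¹)
        ((derivative P).eval x - 1 / x ^ 4) x := by
      intro x hx
      have hx0 : x ≠ 0 := (hδ.trans_le hx.1).ne'
      have h3 := ((hasDerivAt_pow 3 x).inv (pow_ne_zero 3 hx0)).const_mul (1 / 3 : ℝ)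
      refine ((P.hasDerivAt x).add h3).congr_deriv ?_
      field_simp
      push_cast
      ring
    refine antitoneOn_of_deriv_nonpos (convex_Icc δ 1)
      (fun x hx => (hd x hx).continuousAt.continuousWithinAt)
      (fun x hx => (hd x (interior_subset hx)).differentiableAt.differentiableWithinAt)
      (fun x hx => ?_)
    rw [(hd x (interior_subset hx)).deriv]
    linarith [h x (interior_subset hx)]
  have := key (Set.left_mem_Icc.2 hδ1) (Set.right_mem_Icc.2 hδ1) hδ1
  have e : 1 / (3 * δ ^ 3) = 1 / 3 * (δ ^ 3)⁻¹ := by field_simp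
  rw [e]
  norm_num at this ⊢
  linarith

open Polynomial in
/-- A monotone polynomial step from `0` at `-1` to `1` at `1` whose transition near the origin has
width of order `1 / (4 j + 1)`. It is the normalized antiderivative of the fourth power of
`T (4 j + 1) / X`, a kernel of Jackson type. -/
lemma exists_step_polynomial {j : ℕ} (hj : 1 ≤ j) :
    ∃ S : ℝ[X], S.natDegree ≤ 16 * j + 5 ∧ Monotone (fun x => S.eval x) ∧
      S.eval (-1) = 0 ∧ S.eval 1 = 1 ∧
      (∀ δ : ℝ, 0 < δ → δ ≤ 1 → S.eval (-δ) ≤ 6 / ((4 * j + 1) * δ) ^ 3 ∧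
        1 - S.eval δ ≤ 6 / ((4 * j + 1) * δ) ^ 3) ∧
      ∀ x : ℝ, 1 ≤ |x| → |S.eval x| ≤ (3 * |x|) ^ (16 * j + 5) := by
  set T := Chebyshev.T ℝ (4 * j + 1 : ℕ) with hT
  set M : ℝ := 4 * j + 1 with hM
  have hj' : (1 : ℝ) ≤ j := by exact_mod_cast hj
  have hM5 : 5 ≤ M := by linarith
  set Q := T.divX with hQ
  have hTQ : ∀ x, T.eval x = Q.eval x * x := by
    intro x
    have h0 : T.coeff 0 = 0 := by
      rw [coeff_zero_eq_eval_zero]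
      exact Chebyshev.T_eval_zero_of_odd (n := (4 * j + 1 : ℕ)) ℝ ⟨2 * j, by push_cast; ring⟩
    conv_lhs => rw [← divX_mul_X_add T, h0]
    simp [hQ]
  have hQdeg : Q.natDegree ≤ 4 * j := by
    rw [hQ, natDegree_divX_eq_natDegree_tsub_one, hT, Chebyshev.natDegree_T, Int.natAbs_natCast]
    simp
  obtain ⟨P, hP, hPdeg⟩ := exists_antiderivative (Q ^ 4)
  have hP' : ∀ x, (derivative P).eval x = Q.eval x ^ 4 := by intro x; rw [hP, eval_pow]
  have hmono : Monotone fun x => P.eval x := by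
    refine monotone_of_deriv_nonneg P.differentiable fun x => ?_
    rw [Polynomial.deriv, hP']
    positivity
  set Z := P.eval 1 - P.eval (-1) with hZ
  have hZM : M ^ 3 / 16 ≤ Z := by
    have hb : ∀ x ∈ Set.Icc (-(1 / (2 * M))) (1 / (2 * M)),
        (M / 2) ^ 4 ≤ (derivative P).eval x := by
      intro x hx
      rw [hP']
      have hxa : M * |x| ≤ 1 / 2 := by
        have := abs_le.2 hx
        rw [le_div_iff₀ (by positivity)] at this
        linarith
      -- The bound on `T / X` is first obtained away from the origin, then extended by continuity.
      have hcl : ∀ y : ℝ, y ≠ 0 → M * |y| ≤ 1 / 2 → (M / 2) ^ 4 ≤ Q.eval y ^ 4 := by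
        intro y hy hya
        have h1 := le_abs_eval_chebyshevT j hya
        rw [← hT, hTQ, abs_mul] at h1
        have hy' := abs_pos.2 hy
        have h2 : M / 2 ≤ |Q.eval y| := by
          by_contra! hlt
          nlinarith
        calc (M / 2) ^ 4 ≤ |Q.eval y| ^ 4 := by gcongr
          _ = Q.eval y ^ 4 := (Even.pow_abs (by decide) _)
      by_cases hx0 : x = 0
      · subst hx0
        have ht : Filter.Tendsto (fun y : ℝ => Q.eval y ^ 4) (nhdsWithin 0 {0}ᶜ)
            (nhds (Q.eval 0 ^ 4)) :=
          ((Q.continuous.pow 4).tendsto 0).mono_left nhdsWithin_le_nhds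
        refine ge_of_tendsto ht ?_
        have hc : ∀ᶠ y : ℝ in nhds 0, M * |y| < 1 / 2 := by
          refine (continuous_const.mul continuous_abs).continuousAt.eventually_lt
            continuousAt_const ?_
          simp
        filter_upwards [nhdsWithin_le_nhds hc, self_mem_nhdsWithin] with y h1 h2
        exact hcl y h2 h1.le
      · exact hcl x hx0 hxa
    have hpos : 0 < 1 / (2 * M) := by positivity
    have h1 : 1 / (2 * M) ≤ 1 := by
      rw [div_le_one (by positivity)]; linarith
    have h2 := le_eval_sub_eval (P := P) (by linarith) hb
    have h3 : P.eval (1 / (2 * M)) ≤ P.eval 1 := hmono h1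
    have h4 : P.eval (-1) ≤ P.eval (-(1 / (2 * M))) := hmono (by linarith)
    have e : (M / 2) ^ 4 * (1 / (2 * M) - -(1 / (2 * M))) = M ^ 3 / 16 := by
      field_simp
      norm_num
    linarith
  have hZ1 : 1 ≤ Z := by
    refine le_trans ?_ hZM
    have : (5 : ℝ) ^ 3 ≤ M ^ 3 := by gcongr
    linarith
  have hZ0 : 0 < Z := by linarith
  have hQle : ∀ x, 0 < |x| → |x| ≤ 1 → Q.eval x ^ 4 ≤ 1 / |x| ^ 4 := by
    intro x h0 h1
    have h2 := Chebyshev.abs_eval_T_real_le_one (4 * j + 1 : ℕ) h1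
    rw [← hT, hTQ, abs_mul] at h2
    rw [le_div_iff₀ (by positivity), ← Even.pow_abs (by decide : Even 4) (Q.eval x), ← mul_pow]
    exact pow_le_one₀ (by positivity) h2
  have hQbig : ∀ x r, 1 ≤ r → |x| ≤ r → 1 ≤ |x| → Q.eval x ^ 4 ≤ (3 * r) ^ (16 * j + 4) := by
    intro x r hr hxr hx
    have h2 := abs_eval_chebyshevT_le hx (4 * j + 1)
    rw [← hT, hTQ, abs_mul] at h2
    have h3 : |Q.eval x| ≤ (3 * r) ^ (4 * j + 1) := by
      refine le_trans ?_ (h2.trans (by gcongr))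
      exact le_mul_of_one_le_right (abs_nonneg _) hx
    calc Q.eval x ^ 4 = |Q.eval x| ^ 4 := (Even.pow_abs (by decide) _).symm
      _ ≤ ((3 * r) ^ (4 * j + 1)) ^ 4 := by gcongr
      _ = (3 * r) ^ (16 * j + 4) := by rw [← pow_mul]; congr 1; ring
  have hS : ∀ x, (C (1 / Z) * (P - C (P.eval (-1)))).eval x = (P.eval x - P.eval (-1)) / Z := by
    intro x
    simp only [eval_mul, eval_sub, eval_C]
    ring
  refine ⟨C (1 / Z) * (P - C (P.eval (-1))), ?_, ?_, ?_, ?_, ?_, ?_⟩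
  · refine (natDegree_C_mul_le _ _).trans ?_
    rw [natDegree_sub_C]
    have := natDegree_pow_le (p := Q) (n := 4)
    omega
  · intro x y hxy
    simp only [hS]
    have := hmono hxy
    simp only at this
    gcongr
  · rw [hS]; simp
  · rw [hS]; exact div_self hZ0.ne'
  · intro δ h0 h1
    have hq : 1 / (3 * δ ^ 3) / Z ≤ 6 / (M * δ) ^ 3 := by
      have : 1 / (3 * δ ^ 3) / Z ≤ 1 / (3 * δ ^ 3) / (M ^ 3 / 16) := by gcongr
      refine this.trans ?_
      rw [div_div, div_le_div_iff₀ (by positivity) (by positivity)]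
      have : 0 < M ^ 3 * δ ^ 3 := by positivity
      ring_nf
      nlinarith
    constructor
    · rw [hS]
      refine le_trans ?_ hq
      gcongr
      have := eval_one_sub_eval_le (P := -P.comp (-X)) h0 h1 fun x hx => by
        have hx0 : 0 < x := h0.trans_le hx.1
        have := hQle (-x) (by rw [abs_neg, abs_of_pos hx0]; exact hx0)
          (by rw [abs_neg, abs_of_pos hx0]; exact hx.2)
        rw [abs_neg, abs_of_pos hx0] at this
        simpa [derivative_comp, hP', hP] using this
      simp only [eval_neg, eval_comp, eval_X] at this
      linarith
    · rw [hS]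
      have e : 1 - (P.eval δ - P.eval (-1)) / Z = (P.eval 1 - P.eval δ) / Z := by
        field_simp
        rw [hZ]; ring
      rw [e]
      refine le_trans ?_ hq
      gcongr
      refine eval_one_sub_eval_le h0 h1 fun x hx => ?_
      have hx0 : 0 < x := h0.trans_le hx.1
      have := hQle x (by rw [abs_of_pos hx0]; exact hx0) (by rw [abs_of_pos hx0]; exact hx.2)
      rw [abs_of_pos hx0] at this
      rwa [hP']
  · intro x hx
    rw [hS]
    have hB : 0 < (3 * |x|) ^ (16 * j + 4) := by positivity
    have hB1 : 1 ≤ (3 * |x|) ^ (16 * j + 4) := one_le_pow₀ (by linarith)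
    have e : (3 * |x|) ^ (16 * j + 5) = (3 * |x|) ^ (16 * j + 4) * (3 * |x|) := pow_succ _ _
    rw [e, abs_le]
    rcases le_abs.1 hx with h | h
    · have hxp : |x| = x := abs_of_nonneg (by linarith)
      rw [hxp] at hB hB1 ⊢
      have h1 := eval_sub_eval_le (P := P) (c := (3 * x) ^ (16 * j + 4)) h fun y hy => by
        rw [hP']
        have hy0 : 0 ≤ y := by linarith [hy.1]
        exact hQbig y x h (by rw [abs_of_nonneg hy0]; exact hy.2)
          (by rw [abs_of_nonneg hy0]; exact hy.1)
      have h2 : P.eval (-1) ≤ P.eval x := hmono (by linarith)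
      constructor
      · have : 0 ≤ (P.eval x - P.eval (-1)) / Z := div_nonneg (by linarith) hZ0.le
        nlinarith
      · rw [div_le_iff₀ hZ0]
        nlinarith [mul_nonneg hB.le (by linarith : 0 ≤ x - 1), mul_nonneg
          (mul_nonneg hB.le (by linarith : (0 : ℝ) ≤ x)) (by linarith : 0 ≤ Z - 1)]
    · have hxn : |x| = -x := abs_of_nonpos (by linarith)
      rw [hxn] at hB hB1 ⊢
      have h1 := eval_sub_eval_le (P := P) (u := x) (v := -1) (c := (3 * -x) ^ (16 * j + 4))
        (by linarith) fun y hy => by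
        rw [hP']
        have hy0 : y ≤ 0 := by linarith [hy.2]
        exact hQbig y (-x) h (by rw [abs_of_nonpos hy0]; linarith [hy.1])
          (by rw [abs_of_nonpos hy0]; linarith [hy.2])
      have h2 : P.eval x ≤ P.eval (-1) := hmono (by linarith)
      constructor
      · rw [le_div_iff₀ hZ0]
        nlinarith [mul_nonneg hB.le (by linarith : 0 ≤ -x - 1), mul_nonneg
          (mul_nonneg hB.le (by linarith : (0 : ℝ) ≤ -x)) (by linarith : 0 ≤ Z - 1)]
      · have : (P.eval x - P.eval (-1)) / Z ≤ 0 := div_nonpos_of_nonpos_of_nonneg (by linarith) hZ0.le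
        nlinarith

/-! ### Threshold probabilities -/

lemma sum_option_units {M : Type*} [AddCommMonoid M] (f : Option ℤˣ → M) :
    ∑ c, f c = f none + (f (some 1) + f (some (-1))) := by
  rw [Fintype.sum_option, UnitsInt.univ, Finset.sum_pair (by decide)]

open Polynomial in
/-- Polynomial probabilities for a threshold at `t`. On `[-R, R]` they form a probability vector on
`Option ℤˣ`, where `some u` is the verdict that the sign of `y - t` is `u` and `none` is abstention:
the wrong verdict is unlikely, and so is abstention at distance more than `ρ` from `t`. The last
clause controls the growth outside `[-R, R]`. -/
lemma exists_threshold_polynomials {j : ℕ} (hj : 1 ≤ j) (t : ℝ) {R ρ η : ℝ} (hR : 0 < R)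
    (hρ : 0 < ρ) (hρR : ρ ≤ R) (hη : 6 / ((4 * j + 1) * (ρ / (8 * R))) ^ 3 ≤ η) :
    ∃ p : Option ℤˣ → ℝ[X], (∀ c, (p c).natDegree ≤ 16 * j + 5) ∧
      (∀ y, ∑ c, (p c).eval y = 1) ∧
      (∀ y, |y| ≤ R → ∀ c, 0 ≤ (p c).eval y) ∧
      (∀ y, |y| ≤ R → (p (some (-(if t ≤ y then 1 else -1)))).eval y ≤ η) ∧
      (∀ y, |y| ≤ R → ρ < |y - t| → (p none).eval y ≤ η) ∧
      ∀ y, R ≤ |y| → ∑ c, |(p c).eval y| ≤ (15 * (|y| / R)) ^ (16 * j + 5) := by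
  have hη0 : 0 ≤ η := le_trans (by positivity) hη
  have hbase : ∀ y, R ≤ |y| → 1 ≤ |y| / R := fun y hy => (one_le_div hR).2 hy
  have hne : (some (-1 : ℤˣ)) ≠ some 1 := by decide
  have hne' : (some (1 : ℤˣ)) ≠ some (-1) := by decide
  -- A threshold outside `[-2 R, 2 R]` is decided by a constant verdict.
  have hconst : ∀ u : ℤˣ, (∀ y, |y| ≤ R → (if t ≤ y then 1 else -1) = u) → ∃ p : Option ℤˣ → ℝ[X],
      (∀ c, (p c).natDegree ≤ 16 * j + 5) ∧
      (∀ y, ∑ c, (p c).eval y = 1) ∧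
      (∀ y, |y| ≤ R → ∀ c, 0 ≤ (p c).eval y) ∧
      (∀ y, |y| ≤ R → (p (some (-(if t ≤ y then 1 else -1)))).eval y ≤ η) ∧
      (∀ y, |y| ≤ R → ρ < |y - t| → (p none).eval y ≤ η) ∧
      ∀ y, R ≤ |y| → ∑ c, |(p c).eval y| ≤ (15 * (|y| / R)) ^ (16 * j + 5) := by
    intro u hu
    refine ⟨fun c => if c = some u then 1 else 0, ?_, ?_, ?_, ?_, ?_, ?_⟩
    · intro c
      by_cases h : c = some u <;> simp [h]
    · intro y
      rcases Int.units_eq_one_or u with rfl | rfl <;> simp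
    · intro y _ c
      by_cases h : c = some u <;> simp [h]
    · intro y hy
      rw [hu y hy]
      rcases Int.units_eq_one_or u with rfl | rfl <;> simpa [hne, hne'] using hη0
    · intro y _ _
      simpa using hη0
    · intro y hy
      refine le_trans ?_ (one_le_pow₀ (by linarith [hbase y hy]))
      rcases Int.units_eq_one_or u with rfl | rfl <;> simp
  rcases lt_or_ge (2 * R) t with ht | ht
  · exact hconst (-1) fun y hy => if_neg (by linarith [le_abs_self y])
  rcases lt_or_ge t (-(2 * R)) with ht' | ht'
  · exact hconst 1 fun y hy => if_pos (by linarith [neg_abs_le y])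
  obtain ⟨S, hdeg, hmono, hS0, hS1, htail, hgrow⟩ := exists_step_polynomial hj
  set δ := ρ / (8 * R) with hδ
  have hδ0 : 0 < δ := by positivity
  have hδ1 : δ ≤ 1 / 8 := by
    rw [hδ, div_le_iff₀ (by positivity)]; linarith
  obtain ⟨hlow, hhigh⟩ := htail δ hδ0 (by linarith)
  replace hlow := hlow.trans hη
  replace hhigh := hhigh.trans hη
  set A : ℝ[X] := S.comp (C (1 / (4 * R)) * (X - C t) - C δ) with hA
  set B : ℝ[X] := S.comp (C (1 / (4 * R)) * (X - C t) + C δ) with hB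
  have hAe : ∀ y, A.eval y = S.eval ((y - t) / (4 * R) - δ) := by
    intro y; simp [hA, eval_comp]; congr 2; ring
  have hBe : ∀ y, B.eval y = S.eval ((y - t) / (4 * R) + δ) := by
    intro y; simp [hB, eval_comp]; congr 2; ring
  have hAdeg : A.natDegree ≤ 16 * j + 5 := by
    refine natDegree_comp_le.trans ?_
    have : (C (1 / (4 * R)) * (X - C t) - C δ).natDegree ≤ 1 := by
      rw [natDegree_sub_C]
      exact (natDegree_C_mul_le _ _).trans (natDegree_X_sub_C_le t)
    nlinarith
  have hBdeg : B.natDegree ≤ 16 * j + 5 := by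
    refine natDegree_comp_le.trans ?_
    have : (C (1 / (4 * R)) * (X - C t) + C δ).natDegree ≤ 1 := by
      rw [natDegree_add_C]
      exact (natDegree_C_mul_le _ _).trans (natDegree_X_sub_C_le t)
    nlinarith
  have hu : ∀ y, |y| ≤ R → |(y - t) / (4 * R)| ≤ 3 / 4 := by
    intro y hy
    rw [abs_div, abs_of_pos (by positivity : 0 < 4 * R), div_le_iff₀ (by positivity)]
    have h2 : |t| ≤ 2 * R := abs_le.2 ⟨ht', ht⟩
    have := abs_sub y t
    linarith
  have hAB : ∀ y, A.eval y ≤ B.eval y := by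
    intro y
    rw [hAe, hBe]
    exact hmono (by linarith)
  refine ⟨fun c => c.elim (B - A) fun u => if u = 1 then A else 1 - B, ?_, ?_, ?_, ?_, ?_, ?_⟩
  · intro c
    rcases c with _ | u
    · exact (natDegree_sub_le _ _).trans (max_le hBdeg hAdeg)
    · by_cases h : u = 1
      · simpa [h] using hAdeg
      · have := natDegree_sub_le 1 B
        rw [natDegree_one] at this
        simpa [h] using this.trans (max_le (Nat.zero_le _) hBdeg)
  · intro y
    have : ¬ ((-1 : ℤˣ) = 1) := by decide
    simp [this]
    ring
  · intro y hy c
    obtain ⟨h1, h2⟩ := abs_le.1 (hu y hy)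
    rcases c with _ | u
    · simpa using hAB y
    · by_cases h : u = 1
      · simp only [Option.elim_some, h, if_true, hAe]
        rw [← hS0]
        exact hmono (by linarith)
      · simp only [Option.elim_some, h, if_false, eval_sub, eval_one, hBe]
        rw [← hS1, sub_nonneg]
        exact hmono (by linarith)
  · intro y hy
    have hno : ¬ ((-1 : ℤˣ) = 1) := by decide
    by_cases h : t ≤ y
    · have h0 : 0 ≤ (y - t) / (4 * R) := div_nonneg (by linarith) (by positivity)
      simp only [if_pos h, Option.elim_some, if_neg hno, eval_sub, eval_one, hBe]
      have : S.eval δ ≤ S.eval ((y - t) / (4 * R) + δ) := hmono (by linarith)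
      linarith
    · have h0 : (y - t) / (4 * R) ≤ 0 := div_nonpos_of_nonpos_of_nonneg (by linarith) (by positivity)
      simp only [if_neg h, Option.elim_some, neg_neg, if_true, hAe]
      have : S.eval ((y - t) / (4 * R) - δ) ≤ S.eval (-δ) := hmono (by linarith)
      linarith
  · intro y hy hyt
    obtain ⟨h1, h2⟩ := abs_le.1 (hu y hy)
    simp only [Option.elim_none, eval_sub, hAe, hBe]
    have h2δ : 2 * δ = ρ / (4 * R) := by rw [hδ]; field_simp; norm_num
    rcases lt_abs.1 hyt with h | h
    · have h3 : 2 * δ ≤ (y - t) / (4 * R) := by rw [h2δ]; gcongr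
      have h4 : S.eval δ ≤ S.eval ((y - t) / (4 * R) - δ) := hmono (by linarith)
      have h5 : S.eval ((y - t) / (4 * R) + δ) ≤ S.eval 1 := hmono (by linarith)
      linarith
    · have h3 : 2 * δ ≤ -((y - t) / (4 * R)) := by rw [h2δ, ← neg_div]; gcongr
      have h4 : S.eval ((y - t) / (4 * R) + δ) ≤ S.eval (-δ) := hmono (by linarith)
      have h5 : S.eval (-1) ≤ S.eval ((y - t) / (4 * R) - δ) := hmono (by linarith)
      linarith
  · intro y hy
    have hv := hbase y hy
    set v := |y| / R with hv'
    have hbound : ∀ x, |x| ≤ v → |S.eval x| ≤ (3 * v) ^ (16 * j + 5) := by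
      intro x hx
      rcases le_total 1 |x| with h | h
      · exact (hgrow x h).trans (by gcongr)
      · obtain ⟨h1, h2⟩ := abs_le.1 h
        have h3 : S.eval (-1) ≤ S.eval x := hmono h1
        have h4 : S.eval x ≤ S.eval 1 := hmono h2
        have : 1 ≤ (3 * v) ^ (16 * j + 5) := one_le_pow₀ (by linarith)
        rw [abs_le]
        constructor <;> linarith
    have huv : |(y - t) / (4 * R)| ≤ 3 / 4 * v := by
      rw [abs_div, abs_of_pos (by positivity : 0 < 4 * R), div_le_iff₀ (by positivity)]
      have h2 : |t| ≤ 2 * R := abs_le.2 ⟨ht', ht⟩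
      have h3 := abs_sub y t
      have h4 : v * R = |y| := by rw [hv']; field_simp
      nlinarith
    obtain ⟨h1, h2⟩ := abs_le.1 huv
    have hAv : |A.eval y| ≤ (3 * v) ^ (16 * j + 5) := by
      rw [hAe]; exact hbound _ (abs_le.2 ⟨by linarith, by linarith⟩)
    have hBv : |B.eval y| ≤ (3 * v) ^ (16 * j + 5) := by
      rw [hBe]; exact hbound _ (abs_le.2 ⟨by linarith, by linarith⟩)
    have hone : 1 ≤ (3 * v) ^ (16 * j + 5) := one_le_pow₀ (by linarith)
    have hno : ¬ ((-1 : ℤˣ) = 1) := by decide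
    simp only [sum_option_units, Option.elim_none, Option.elim_some, if_true, if_neg hno, eval_sub,
      eval_one]
    have h3 := abs_sub (B.eval y) (A.eval y)
    have h4 := abs_sub 1 (B.eval y)
    rw [abs_one] at h4
    have h5 : (5 : ℝ) ^ 1 ≤ 5 ^ (16 * j + 5) := pow_le_pow_right₀ (by norm_num) (by omega)
    calc _ ≤ 5 * (3 * v) ^ (16 * j + 5) := by linarith
      _ ≤ 5 ^ (16 * j + 5) * (3 * v) ^ (16 * j + 5) := by
        gcongr
        simpa using h5
      _ = (15 * v) ^ (16 * j + 5) := by rw [← mul_pow]; congr 1; ring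

/-! ### Mixtures over uncertain signs -/

/-- The largest value of `G` on the sign vectors compatible with the verdicts `c`, where `none`
leaves a sign undetermined. -/
noncomputable def maxCompletion {ι : Type*} (G : (ι → ℤˣ) → ℤˣ) (c : ι → Option ℤˣ) : ℝ :=
  open Classical in
  if ∃ g : ι → ℤˣ, (∀ i, c i ≠ some (-g i)) ∧ G g = 1 then 1 else -1

lemma abs_maxCompletion {ι : Type*} (G : (ι → ℤˣ) → ℤˣ) (c : ι → Option ℤˣ) :
    |maxCompletion G c| = 1 := by
  unfold maxCompletion
  split_ifs <;> simp

lemma le_maxCompletion {ι : Type*} (G : (ι → ℤˣ) → ℤˣ) {c : ι → Option ℤˣ} {g : ι → ℤˣ}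
    (h : ∀ i, c i ≠ some (-g i)) : ((G g : ℤ) : ℝ) ≤ maxCompletion G c := by
  rcases Int.units_eq_one_or (G g) with hg | hg
  · rw [maxCompletion, if_pos ⟨g, h, hg⟩, hg]
    simp
  · rw [hg]
    have := abs_le.1 (abs_maxCompletion G c).le
    simpa using this.1

lemma maxCompletion_add_maxCompletion_neg {ι : Type*} (G : (ι → ℤˣ) → ℤˣ) {c : ι → Option ℤˣ}
    (h : ∀ i, c i ≠ none) :
    maxCompletion G c + maxCompletion (fun g => -G g) c = 0 := by
  choose g hg using fun i => Option.ne_none_iff_exists'.1 (h i)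
  have huniq : ∀ g' : ι → ℤˣ, (∀ i, c i ≠ some (-g' i)) ↔ g' = g := by
    intro g'
    refine ⟨fun H => funext fun i => ?_, ?_⟩
    · have := H i
      rw [hg i, Ne, Option.some_inj] at this
      rcases Int.units_eq_one_or (g i) with h1 | h1 <;>
        rcases Int.units_eq_one_or (g' i) with h2 | h2 <;> simp_all
    · rintro rfl i
      rw [hg i, Ne, Option.some_inj]
      rcases Int.units_eq_one_or (g' i) with h | h <;> rw [h] <;> decide
  unfold maxCompletion
  simp only [huniq, exists_eq_left]
  rcases Int.units_eq_one_or (G g) with h1 | h1 <;> rw [h1] <;> simp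

/-- The expectation of `maxCompletion G` under the product of the (signed) weights `p i`. -/
noncomputable def maxCompletionMean {ι : Type*} [Fintype ι] [DecidableEq ι] (G : (ι → ℤˣ) → ℤˣ)
    (p : ι → Option ℤˣ → ℝ) : ℝ :=
  ∑ c : ι → Option ℤˣ, maxCompletion G c * ∏ i, p i (c i)

lemma one_sub_sum_le_prod_one_sub {ι : Type*} (s : Finset ι) {x : ι → ℝ} (h0 : ∀ i, 0 ≤ x i)
    (h1 : ∀ i, x i ≤ 1) : 1 - ∑ i ∈ s, x i ≤ ∏ i ∈ s, (1 - x i) := by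
  classical
  induction s using Finset.induction_on with
  | empty => simp
  | insert a s ha ih =>
    rw [Finset.sum_insert ha, Finset.prod_insert ha]
    have hp : ∏ i ∈ s, (1 - x i) ≤ 1 :=
      Finset.prod_le_one (fun i _ => by linarith [h1 i]) fun i _ => by linarith [h0 i]
    nlinarith [h0 a, h1 a]

section
variable {ι : Type*} [Fintype ι] [DecidableEq ι] {p : ι → Option ℤˣ → ℝ}

lemma sum_prod_eq_one (hp1 : ∀ i, ∑ c, p i c = 1) :
    ∑ c : ι → Option ℤˣ, ∏ i, p i (c i) = 1 := by
  have := Finset.prod_univ_sum (fun _ : ι => (Finset.univ : Finset (Option ℤˣ))) p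
  rw [Fintype.piFinset_univ] at this
  rw [← this]
  exact Finset.prod_eq_one fun i _ => hp1 i

/-- Union bound for a product of probability vectors. -/
lemma one_sub_sum_le_sum_piFinset_erase (hp : ∀ i c, 0 ≤ p i c) (hp1 : ∀ i, ∑ c, p i c = 1)
    (e : ι → Option ℤˣ) :
    1 - ∑ i, p i (e i) ≤
      ∑ c ∈ Fintype.piFinset fun i => Finset.univ.erase (e i), ∏ i, p i (c i) := by
  rw [← Finset.prod_univ_sum]
  have h : ∀ i, ∑ c ∈ Finset.univ.erase (e i), p i c = 1 - p i (e i) := by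
    intro i
    rw [← hp1 i, ← Finset.add_sum_erase _ _ (Finset.mem_univ (e i))]
    ring
  simp only [h]
  refine one_sub_sum_le_prod_one_sub _ (fun i => hp i _) fun i => ?_
  rw [← hp1 i]
  exact Finset.single_le_sum (fun c _ => hp i c) (Finset.mem_univ _)

/-- On a product of probability vectors the mean of `maxCompletion G` is at least `G g`, up to the
probability that some verdict contradicts `g`. -/
lemma le_maxCompletionMean (G : (ι → ℤˣ) → ℤˣ) (hp : ∀ i c, 0 ≤ p i c)
    (hp1 : ∀ i, ∑ c, p i c = 1) (g : ι → ℤˣ) :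
    ((G g : ℤ) : ℝ) - 2 * ∑ i, p i (some (-g i)) ≤ maxCompletionMean G p := by
  set A := Fintype.piFinset fun i => Finset.univ.erase (some (-g i)) with hA
  have hun := one_sub_sum_le_sum_piFinset_erase hp hp1 fun i => some (-g i)
  have hG : ((G g : ℤ) : ℝ) ≤ 1 := by
    rcases Int.units_eq_one_or (G g) with h | h <;> rw [h] <;> simp
  have hw : ∀ c : ι → Option ℤˣ, 0 ≤ ∏ i, p i (c i) := fun c => Finset.prod_nonneg fun i _ => hp i _
  have hpt : ∀ c : ι → Option ℤˣ, (((G g : ℤ) : ℝ) - 2) * ∏ i, p i (c i) +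
      (if c ∈ A then 2 * ∏ i, p i (c i) else 0) ≤ maxCompletion G c * ∏ i, p i (c i) := by
    intro c
    split_ifs with hc
    · rw [← add_mul]
      refine mul_le_mul_of_nonneg_right ?_ (hw c)
      have := le_maxCompletion G (c := c) (g := g) fun i => by
        have := Fintype.mem_piFinset.1 hc i
        exact Finset.ne_of_mem_erase this
      linarith
    · rw [add_zero]
      refine mul_le_mul_of_nonneg_right ?_ (hw c)
      have := (abs_le.1 (abs_maxCompletion G c).le).1
      linarith
  have := Finset.sum_le_sum fun c (_ : c ∈ Finset.univ) => hpt c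
  rw [Finset.sum_add_distrib, ← Finset.mul_sum, sum_prod_eq_one hp1, ← Finset.sum_filter,
    Finset.filter_mem_eq_inter, Finset.univ_inter, ← Finset.mul_sum] at this
  unfold maxCompletionMean
  linarith

/-- The gap between the means of the largest and the smallest completion: the two agree unless some
verdict is an abstention. The smallest completion of `G` is minus the largest one of `-G`. -/
lemma maxCompletionMean_add_le (G : (ι → ℤˣ) → ℤˣ) (hp : ∀ i c, 0 ≤ p i c)
    (hp1 : ∀ i, ∑ c, p i c = 1) :
    maxCompletionMean G p + maxCompletionMean (fun g => -G g) p ≤ 2 ∧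
      maxCompletionMean G p + maxCompletionMean (fun g => -G g) p ≤ 2 * ∑ i, p i none := by
  set A := Fintype.piFinset fun _ : ι => Finset.univ.erase (none : Option ℤˣ) with hA
  have hun := one_sub_sum_le_sum_piFinset_erase hp hp1 fun _ => none
  have hw : ∀ c : ι → Option ℤˣ, 0 ≤ ∏ i, p i (c i) := fun c => Finset.prod_nonneg fun i _ => hp i _
  have hpt : ∀ c : ι → Option ℤˣ, maxCompletion G c * ∏ i, p i (c i) +
      maxCompletion (fun g => -G g) c * ∏ i, p i (c i) ≤
      2 * ∏ i, p i (c i) - (if c ∈ A then 2 * ∏ i, p i (c i) else 0) := by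
    intro c
    rw [← add_mul]
    split_ifs with hc
    · rw [maxCompletion_add_maxCompletion_neg G fun i =>
        Finset.ne_of_mem_erase (Fintype.mem_piFinset.1 hc i)]
      simp
    · rw [sub_zero]
      refine mul_le_mul_of_nonneg_right ?_ (hw c)
      have h1 := (abs_le.1 (abs_maxCompletion G c).le).2
      have h2 := (abs_le.1 (abs_maxCompletion (fun g => -G g) c).le).2
      linarith
  have := Finset.sum_le_sum fun c (_ : c ∈ Finset.univ) => hpt c
  rw [Finset.sum_add_distrib, Finset.sum_sub_distrib, ← Finset.mul_sum, sum_prod_eq_one hp1,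
    ← Finset.sum_filter, Finset.filter_mem_eq_inter, Finset.univ_inter, ← Finset.mul_sum] at this
  unfold maxCompletionMean
  have h0 : 0 ≤ ∑ c ∈ A, ∏ i, p i (c i) := Finset.sum_nonneg fun c _ => hw c
  constructor <;> linarith

lemma abs_maxCompletionMean_le (G : (ι → ℤˣ) → ℤˣ) :
    |maxCompletionMean G p| ≤ ∏ i, ∑ c, |p i c| := by
  rw [Finset.prod_univ_sum, Fintype.piFinset_univ]
  refine (Finset.abs_sum_le_sum_abs _ _).trans (Finset.sum_le_sum fun c _ => ?_)
  rw [abs_mul, abs_maxCompletion, one_mul, Finset.abs_prod]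

end

/-! ### Sandwiching on the whole space -/

lemma totalDegree_aeval_le {σ : Type*} {L : MvPolynomial σ ℝ} (hL : L.totalDegree ≤ 1)
    (p : Polynomial ℝ) : (Polynomial.aeval L p).totalDegree ≤ p.natDegree := by
  rw [Polynomial.aeval_eq_sum_range]
  refine MvPolynomial.totalDegree_finsetSum_le fun i hi => ?_
  refine (MvPolynomial.totalDegree_smul_le _ _).trans ((MvPolynomial.totalDegree_pow _ _).trans ?_)
  have := Finset.mem_range.1 hi
  nlinarith

/-- The linear form `x ↦ ⟪w, x⟫` as a polynomial in the coordinates of `x`. -/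
noncomputable def innerForm {d : ℕ} (w : EuclideanSpace ℝ (Fin d)) : MvPolynomial (Fin d) ℝ :=
  ∑ j, MvPolynomial.C (w j) * MvPolynomial.X j

lemma eval_innerForm {d : ℕ} (w x : EuclideanSpace ℝ (Fin d)) :
    MvPolynomial.eval (fun i => x i) (innerForm w) = inner ℝ w x := by
  simp [innerForm, PiLp.inner_apply, mul_comm]

lemma totalDegree_innerForm_le {d : ℕ} (w : EuclideanSpace ℝ (Fin d)) :
    (innerForm w).totalDegree ≤ 1 := by
  refine MvPolynomial.totalDegree_finsetSum_le fun i _ => ?_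
  refine (MvPolynomial.totalDegree_mul _ _).trans ?_
  simp

lemma eval_aeval_innerForm {d : ℕ} (w x : EuclideanSpace ℝ (Fin d)) (p : Polynomial ℝ) :
    MvPolynomial.eval (fun i => x i) (Polynomial.aeval (innerForm w) p) =
      p.eval (inner ℝ w x) := by
  rw [Polynomial.aeval_eq_sum_range, Polynomial.eval_eq_sum_range]
  simp [map_sum, MvPolynomial.smul_eval, eval_innerForm]

/-- The mean of `maxCompletion G` for the threshold probabilities `p`, as a polynomial, made
an upper bound by adding a constant and high even powers of the projections. -/
noncomputable def upperPolynomial {d k : ℕ} (w : Fin k → EuclideanSpace ℝ (Fin d))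
    (G : (Fin k → ℤˣ) → ℤˣ) (p : Fin k → Option ℤˣ → Polynomial ℝ) (R η : ℝ) (N : ℕ) :
    MvPolynomial (Fin d) ℝ :=
  ∑ c : Fin k → Option ℤˣ, MvPolynomial.C (maxCompletion G c) *
      ∏ i, Polynomial.aeval (innerForm (w i)) (p i (c i)) +
    MvPolynomial.C (2 * (k * η)) +
    ∑ i, (MvPolynomial.C (15 / R) * innerForm (w i)) ^ (2 * N)

lemma eval_upperPolynomial {d k : ℕ} (w : Fin k → EuclideanSpace ℝ (Fin d))
    (G : (Fin k → ℤˣ) → ℤˣ) (p : Fin k → Option ℤˣ → Polynomial ℝ) (R η : ℝ) (N : ℕ)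
    (x : EuclideanSpace ℝ (Fin d)) :
    MvPolynomial.eval (fun i => x i) (upperPolynomial w G p R η N) =
      maxCompletionMean G (fun i c => (p i c).eval (inner ℝ (w i) x)) + 2 * (k * η) +
        ∑ i, (15 / R * inner ℝ (w i) x) ^ (2 * N) := by
  simp only [upperPolynomial, map_add, map_sum, map_mul, map_prod, map_pow, MvPolynomial.eval_C,
    eval_aeval_innerForm, eval_innerForm, maxCompletionMean]

lemma totalDegree_upperPolynomial_le {d k m : ℕ} (w : Fin k → EuclideanSpace ℝ (Fin d))
    (G : (Fin k → ℤˣ) → ℤˣ) {p : Fin k → Option ℤˣ → Polynomial ℝ} (R η : ℝ) {N : ℕ}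
    (hp : ∀ i c, (p i c).natDegree ≤ m) (hN : k * m ≤ N) :
    (upperPolynomial w G p R η N).totalDegree ≤ 2 * N := by
  have h1 : (∑ c : Fin k → Option ℤˣ, MvPolynomial.C (maxCompletion G c) *
      ∏ i, Polynomial.aeval (innerForm (w i)) (p i (c i))).totalDegree ≤ 2 * N := by
    refine MvPolynomial.totalDegree_finsetSum_le fun c _ => ?_
    refine (MvPolynomial.totalDegree_mul _ _).trans ?_
    rw [MvPolynomial.totalDegree_C, zero_add]
    refine (MvPolynomial.totalDegree_finsetProd _ _).trans ?_
    calc _ ≤ ∑ _i : Fin k, m := Finset.sum_le_sum fun i _ =>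
          (totalDegree_aeval_le (totalDegree_innerForm_le _) _).trans (hp i _)
      _ ≤ 2 * N := by simp; omega
  have h2 : (∑ i, (MvPolynomial.C (15 / R) * innerForm (w i)) ^ (2 * N)).totalDegree ≤ 2 * N := by
    refine MvPolynomial.totalDegree_finsetSum_le fun i _ => ?_
    refine (MvPolynomial.totalDegree_pow _ _).trans ?_
    have := MvPolynomial.totalDegree_mul (MvPolynomial.C (15 / R)) (innerForm (w i))
    rw [MvPolynomial.totalDegree_C, zero_add] at this
    nlinarith [this.trans (totalDegree_innerForm_le (w i))]
  refine (MvPolynomial.totalDegree_add _ _).trans (max_le ?_ h2)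
  refine (MvPolynomial.totalDegree_add _ _).trans (max_le h1 ?_)
  rw [MvPolynomial.totalDegree_C]
  exact Nat.zero_le _

/-- Pointwise sandwiching: the gap is at most `2` near the boundary of one of the halfspaces and
small elsewhere, up to high powers of the rescaled projections. -/
theorem exists_pointwise_sandwich {d k j N : ℕ} (w : Fin k → EuclideanSpace ℝ (Fin d))
    (t : Fin k → ℝ) (G : (Fin k → ℤˣ) → ℤˣ) (hj : 1 ≤ j) {R ρ η : ℝ} (hR : 0 < R)
    (hρ : 0 < ρ) (hρR : ρ ≤ R) (hη : 6 / ((4 * j + 1) * (ρ / (8 * R))) ^ 3 ≤ η)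
    (hN : k * (16 * j + 5) ≤ N) :
    ∃ pUp pDown : MvPolynomial (Fin d) ℝ, pUp.totalDegree ≤ 2 * N ∧ pDown.totalDegree ≤ 2 * N ∧
      ∀ x : EuclideanSpace ℝ (Fin d),
        MvPolynomial.eval (fun i => x i) pDown ≤ ((G fun i => halfspace (w i) (t i) x : ℤ) : ℝ) ∧
        ((G fun i => halfspace (w i) (t i) x : ℤ) : ℝ) ≤ MvPolynomial.eval (fun i => x i) pUp ∧
        MvPolynomial.eval (fun i => x i) pUp - MvPolynomial.eval (fun i => x i) pDown ≤
          (⋃ i, {x | |inner ℝ (w i) x - t i| ≤ ρ}).indicator (fun _ => (2 : ℝ)) x +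
            6 * (k * η) + 4 * ∑ i, (15 / R * inner ℝ (w i) x) ^ (2 * N) := by
  choose p hdeg hsum hpos hwrong hnone hgrow using
    fun i => exists_threshold_polynomials hj (t i) hR hρ hρR hη
  have hη0 : 0 ≤ η := le_trans (by positivity) hη
  have hkη : 0 ≤ k * η := by positivity
  have hW : ∀ x, 0 ≤ ∑ i, (15 / R * inner ℝ (w i) x) ^ (2 * N) := fun x =>
    Finset.sum_nonneg fun i _ => Even.pow_nonneg (even_two_mul N) _
  have hG1 : ∀ G' : (Fin k → ℤˣ) → ℤˣ, ∀ g, ((G' g : ℤ) : ℝ) ≤ 1 := by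
    intro G' g
    rcases Int.units_eq_one_or (G' g) with h | h <;> rw [h] <;> simp
  -- Outside the cube the powers dominate the value of every mean.
  have hout : ∀ x, ¬ (∀ i, |inner ℝ (w i) x| ≤ R) → ∀ G' : (Fin k → ℤˣ) → ℤˣ,
      1 + |maxCompletionMean G' (fun i c => (p i c).eval (inner ℝ (w i) x))| ≤
        ∑ i, (15 / R * inner ℝ (w i) x) ^ (2 * N) := by
    intro x hx G'
    push Not at hx
    obtain ⟨i₁, hi₁⟩ := hx
    obtain ⟨i₀, -, hi₀⟩ := Finset.exists_max_image Finset.univ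
      (fun i => |(inner ℝ (w i) x : ℝ)|) ⟨i₁, Finset.mem_univ _⟩
    set V : ℝ := |inner ℝ (w i₀) x| / R with hV
    have hV1 : 1 ≤ V := (one_le_div hR).2 (hi₁.le.trans (hi₀ i₁ (Finset.mem_univ _)))
    have hfac : ∀ i, ∑ c, |(p i c).eval (inner ℝ (w i) x)| ≤ (15 * V) ^ (16 * j + 5) := by
      intro i
      rcases le_total |(inner ℝ (w i) x : ℝ)| R with h | h
      · simp only [abs_of_nonneg (hpos i _ h _), hsum]
        exact one_le_pow₀ (by linarith)
      · refine (hgrow i _ h).trans ?_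
        have : |inner ℝ (w i) x| / R ≤ V := by
          rw [hV]
          exact div_le_div_of_nonneg_right (hi₀ i (Finset.mem_univ _)) hR.le
        gcongr
    have hu : |maxCompletionMean G' (fun i c => (p i c).eval (inner ℝ (w i) x))| ≤
        (15 * V) ^ N := by
      refine (abs_maxCompletionMean_le G').trans ?_
      calc _ ≤ ∏ _i : Fin k, (15 * V) ^ (16 * j + 5) := Finset.prod_le_prod
            (fun i _ => Finset.sum_nonneg fun c _ => abs_nonneg _) fun i _ => hfac i
        _ = (15 * V) ^ (k * (16 * j + 5)) := by
            rw [Finset.prod_const, Finset.card_univ, Fintype.card_fin, ← pow_mul, mul_comm k]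
        _ ≤ (15 * V) ^ N := pow_le_pow_right₀ (by linarith) hN
    have hN1 : 1 ≤ N := by
      have : 0 < k := i₁.pos
      nlinarith
    have hbig : 15 ≤ (15 * V) ^ N :=
      le_trans (by linarith) (le_self_pow₀ (by linarith : 1 ≤ 15 * V) (by omega))
    have hterm : ((15 * V) ^ N) ^ 2 = (15 / R * inner ℝ (w i₀) x) ^ (2 * N) := by
      rw [← pow_mul, mul_comm N 2, ← Even.pow_abs (even_two_mul N) (15 / R * _), abs_mul,
        abs_of_pos (by positivity : 0 < 15 / R), hV]
      congr 1
      ring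
    have hle : (15 / R * inner ℝ (w i₀) x) ^ (2 * N) ≤
        ∑ i, (15 / R * inner ℝ (w i) x) ^ (2 * N) :=
      Finset.single_le_sum (f := fun i => (15 / R * inner ℝ (w i) x) ^ (2 * N))
        (fun i _ => Even.pow_nonneg (even_two_mul N) _) (Finset.mem_univ i₀)
    nlinarith
  have hup : ∀ G' : (Fin k → ℤˣ) → ℤˣ, ∀ x, ((G' fun i => halfspace (w i) (t i) x : ℤ) : ℝ) ≤
      MvPolynomial.eval (fun i => x i) (upperPolynomial w G' p R η N) := by
    intro G' x
    rw [eval_upperPolynomial]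
    by_cases hx : ∀ i, |inner ℝ (w i) x| ≤ R
    · have h1 := le_maxCompletionMean G' (p := fun i c => (p i c).eval (inner ℝ (w i) x))
        (fun i c => hpos i _ (hx i) c) (fun i => hsum i _) fun i => halfspace (w i) (t i) x
      have h2 : ∑ i, (p i (some (-halfspace (w i) (t i) x))).eval (inner ℝ (w i) x) ≤ k * η := by
        calc _ ≤ ∑ _i : Fin k, η := Finset.sum_le_sum fun i _ => hwrong i _ (hx i)
          _ = k * η := by simp
      linarith [hW x]
    · have h1 := hout x hx G'
      have h2 := neg_abs_le (maxCompletionMean G' (fun i c => (p i c).eval (inner ℝ (w i) x)))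
      linarith [hG1 G' fun i => halfspace (w i) (t i) x]
  refine ⟨upperPolynomial w G p R η N, -upperPolynomial w (fun g => -G g) p R η N,
    totalDegree_upperPolynomial_le w G R η hdeg hN, ?_, fun x => ⟨?_, hup G x, ?_⟩⟩
  · rw [MvPolynomial.totalDegree_neg]
    exact totalDegree_upperPolynomial_le w _ R η hdeg hN
  · have := hup (fun g => -G g) x
    rw [map_neg]
    push_cast at this
    linarith
  · rw [map_neg, sub_neg_eq_add, eval_upperPolynomial, eval_upperPolynomial]
    set B := ⋃ i, {x | |inner ℝ (w i) x - t i| ≤ ρ} with hB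
    have hind : 0 ≤ B.indicator (fun _ => (2 : ℝ)) x := Set.indicator_nonneg (by simp) x
    by_cases hx : ∀ i, |inner ℝ (w i) x| ≤ R
    · have h1 := maxCompletionMean_add_le G (p := fun i c => (p i c).eval (inner ℝ (w i) x))
        (fun i c => hpos i _ (hx i) c) (fun i => hsum i _)
      by_cases hb : x ∈ B
      · rw [Set.indicator_of_mem hb]
        linarith [hW x, h1.1]
      · rw [Set.indicator_of_notMem hb]
        have h2 : ∑ i, (p i none).eval (inner ℝ (w i) x) ≤ k * η := by
          calc _ ≤ ∑ _i : Fin k, η := Finset.sum_le_sum fun i _ => hnone i _ (hx i) (by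
                simp only [hB, Set.mem_iUnion, Set.mem_ofPred_eq, not_exists, not_le] at hb
                exact hb i)
            _ = k * η := by simp
        linarith [hW x, h1.2]
    · have h1 := hout x hx G
      have h2 := hout x hx fun g => -G g
      have h3 := le_abs_self (maxCompletionMean G fun i c => (p i c).eval (inner ℝ (w i) x))
      have h4 := le_abs_self
        (maxCompletionMean (fun g => -G g) fun i c => (p i c).eval (inner ℝ (w i) x))
      linarith

/-! ### Moments -/

/-- `r ^ n * exp (-b * r ^ p)` is at most `S ^ n` when `S ^ p ≥ n / b`. -/
lemma rpow_mul_exp_le {b p n S r : ℝ} (hb : 0 < b) (hp : 1 ≤ p) (hn : 0 ≤ n) (hS : 0 < S)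
    (h : n / b ≤ S ^ p) (hr : 0 < r) : r ^ n * Real.exp (-b * r ^ p) ≤ S ^ n := by
  have hrS : 0 < r / S := by positivity
  have h1 : Real.log (r / S) ≤ (r / S) ^ p := by
    have h2 := Real.log_le_sub_one_of_pos (Real.rpow_pos_of_pos hrS p)
    rw [Real.log_rpow hrS] at h2
    have h3 : 0 ≤ (r / S) ^ p := by positivity
    rcases le_total (Real.log (r / S)) 0 with h4 | h4
    · linarith
    · nlinarith
  have h2 : n * (r / S) ^ p ≤ b * r ^ p := by
    rw [Real.div_rpow hr.le hS.le, mul_div_assoc', div_le_iff₀ (by positivity)]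
    rw [div_le_iff₀ hb] at h
    have : 0 ≤ r ^ p := by positivity
    nlinarith
  have h3 : (r / S) ^ n ≤ Real.exp (b * r ^ p) := by
    rw [Real.rpow_def_of_pos hrS, Real.exp_le_exp]
    nlinarith
  rw [Real.div_rpow hr.le hS.le, div_le_iff₀ (by positivity)] at h3
  calc r ^ n * Real.exp (-b * r ^ p) ≤ Real.exp (b * r ^ p) * S ^ n * Real.exp (-b * r ^ p) := by
        gcongr
    _ = S ^ n := by rw [mul_right_comm, ← Real.exp_add]; simp

/-- Moments of a variable with tails `a * exp (-b * r ^ p)`, by the layer cake formula. -/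
lemma lintegral_abs_rpow_le {Ω : Type*} [MeasurableSpace Ω] {μ : Measure Ω}
    [IsProbabilityMeasure μ] {f : Ω → ℝ} (hf : Measurable f) {a b p q S : ℝ} (ha : 0 < a)
    (hb : 0 < b) (hp : 1 ≤ p) (hq : 1 ≤ q) (hS : 0 < S) (hSq : (q + 1) / b ≤ S ^ p)
    (htail : ∀ r, 0 ≤ r → μ {x | r ≤ |f x|} ≤ ENNReal.ofReal (a * Real.exp (-b * r ^ p))) :
    ∫⁻ x, ENNReal.ofReal (|f x| ^ q) ∂μ ≤ ENNReal.ofReal ((1 + a * q) * S ^ q) := by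
  have hq0 : 0 < q := by linarith
  rw [lintegral_rpow_eq_lintegral_meas_le_mul μ (Filter.Eventually.of_forall fun x => abs_nonneg _)
    (by fun_prop) hq0, ← Set.Ioc_union_Ioi_eq_Ioi hS.le,
    lintegral_union measurableSet_Ioi (Set.disjoint_left.2 fun x hx hx' => not_lt.2 hx.2 hx')]
  -- Up to `S` the probability is bounded by one.
  have h1 : ∫⁻ r in Set.Ioc 0 S, μ {x | r ≤ |f x|} * ENNReal.ofReal (r ^ (q - 1)) ≤
      ENNReal.ofReal (S ^ q / q) := by
    have hi : IntegrableOn (fun r : ℝ => r ^ (q - 1)) (Set.Ioc 0 S) := by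
      rw [← intervalIntegrable_iff_integrableOn_Ioc_of_le hS.le]
      exact intervalIntegral.intervalIntegrable_rpow' (by linarith)
    calc _ ≤ ∫⁻ r in Set.Ioc 0 S, ENNReal.ofReal (r ^ (q - 1)) := by
          gcongr with r
          exact mul_le_of_le_one_left' prob_le_one
      _ = ENNReal.ofReal (∫ r in Set.Ioc 0 S, r ^ (q - 1)) := by
          rw [ofReal_integral_eq_lintegral_ofReal hi]
          exact (ae_restrict_iff' measurableSet_Ioc).2 (Filter.Eventually.of_forall fun r hr =>
            Real.rpow_nonneg hr.1.le _)
      _ = ENNReal.ofReal (S ^ q / q) := by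
          rw [← intervalIntegral.integral_of_le hS.le, integral_rpow (Or.inl (by linarith))]
          simp [Real.zero_rpow hq0.ne']
  -- Beyond `S` the integrand is bounded by a multiple of `r ^ (-2)`.
  have h2 : ∫⁻ r in Set.Ioi S, μ {x | r ≤ |f x|} * ENNReal.ofReal (r ^ (q - 1)) ≤
      ENNReal.ofReal (a * S ^ q) := by
    have hi : IntegrableOn (fun r : ℝ => a * S ^ (q + 1) * r ^ (-2 : ℝ)) (Set.Ioi S) :=
      (integrableOn_Ioi_rpow_of_lt (by norm_num) hS).const_mul _
    calc _ ≤ ∫⁻ r in Set.Ioi S, ENNReal.ofReal (a * S ^ (q + 1) * r ^ (-2 : ℝ)) := by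
          refine setLIntegral_mono' measurableSet_Ioi fun r hr => ?_
          have hr0 : 0 < r := hS.trans hr
          calc _ ≤ ENNReal.ofReal (a * Real.exp (-b * r ^ p)) * ENNReal.ofReal (r ^ (q - 1)) := by
                gcongr
                exact htail r hr0.le
            _ ≤ _ := by
                rw [← ENNReal.ofReal_mul (by positivity)]
                refine ENNReal.ofReal_le_ofReal ?_
                have e : r ^ (q - 1) = r ^ (q + 1) * r ^ (-2 : ℝ) := by
                  rw [← Real.rpow_add hr0]; ring_nf
                have := rpow_mul_exp_le hb hp (by linarith : 0 ≤ q + 1) hS hSq hr0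
                have h0 : 0 ≤ a * r ^ (-2 : ℝ) := by positivity
                rw [e]
                nlinarith
      _ = ENNReal.ofReal (∫ r in Set.Ioi S, a * S ^ (q + 1) * r ^ (-2 : ℝ)) := by
          rw [ofReal_integral_eq_lintegral_ofReal hi]
          exact (ae_restrict_iff' measurableSet_Ioi).2 (Filter.Eventually.of_forall fun r hr => by
            have : 0 < r := hS.trans hr
            positivity)
      _ = ENNReal.ofReal (a * S ^ q) := by
          rw [integral_const_mul, integral_Ioi_rpow_of_lt (by norm_num) hS]
          congr 1
          have : S ^ (q + 1) = S ^ q * S := Real.rpow_add_one hS.ne' q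
          rw [this]
          norm_num [Real.rpow_neg_one]
          field_simp
  calc _ ≤ ENNReal.ofReal q * (ENNReal.ofReal (S ^ q / q) + ENNReal.ofReal (a * S ^ q)) := by
        gcongr
    _ = ENNReal.ofReal ((1 + a * q) * S ^ q) := by
        rw [← ENNReal.ofReal_add (by positivity) (by positivity), ← ENNReal.ofReal_mul hq0.le]
        congr 1
        field_simp

/-- The rescaled even power used outside the cube has exponentially small `L^s` norm. -/
lemma eLpNorm_pow_le {Ω : Type*} [MeasurableSpace Ω] {μ : Measure Ω}
    [IsProbabilityMeasure μ] {f : Ω → ℝ} (hf : Measurable f) {a b p s R : ℝ} {N : ℕ} (ha : 0 < a)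
    (hb : 0 < b) (hp : 1 ≤ p) (hs : 1 ≤ s) (hN : 1 ≤ N)
    (hR : 480 * (1 + a) * (1 + 1 / b) * s * (N : ℝ) ^ (1 / p) ≤ R)
    (htail : ∀ r, 0 ≤ r → μ {x | r ≤ |f x|} ≤ ENNReal.ofReal (a * Real.exp (-b * r ^ p))) :
    eLpNorm (fun x => (15 / R * f x) ^ (2 * N)) (ENNReal.ofReal s) μ ≤
      ENNReal.ofReal (1 / N) := by
  have hN' : (1 : ℝ) ≤ N := by exact_mod_cast hN
  have hNp : 0 < (N : ℝ) ^ (1 / p) := by positivity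
  have hR0 : 0 < R := lt_of_lt_of_le (by positivity) hR
  set q : ℝ := 2 * N * s with hq
  have hq2 : 2 ≤ q := by nlinarith
  have hq1 : 1 ≤ q := by linarith
  -- `R` is `120 * (1 + a) = 15 * 4 * 2 * (1 + a)` times the moment scale `S`: the factor `15` is
  -- the rescaling of `f`, `2 * (1 + a)` absorbs `1 + a * q`, and `4` gives the decay `4 ^ (-q)`.
  set S : ℝ := R / (120 * (1 + a)) with hS
  have hS0 : 0 < S := by positivity
  have hSq : (q + 1) / b ≤ S ^ p := by
    have h1 : (1 + 1 / b) * (4 * s) * (N : ℝ) ^ (1 / p) ≤ S := by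
      rw [hS, le_div_iff₀ (by positivity)]
      linarith
    calc (q + 1) / b ≤ (1 + 1 / b) * (4 * s) * N := by
          rw [div_le_iff₀ hb]
          have e : (1 + 1 / b) * (4 * s) * N * b = (b + 1) * (2 * q) := by
            rw [hq]; field_simp; ring
          rw [e]
          nlinarith
      _ ≤ ((1 + 1 / b) * (4 * s)) ^ p * N := by
          gcongr
          refine Real.self_le_rpow_of_one_le ?_ hp
          have : 0 < 1 / b := by positivity
          nlinarith
      _ = ((1 + 1 / b) * (4 * s) * (N : ℝ) ^ (1 / p)) ^ p := by
          rw [Real.mul_rpow (by positivity) hNp.le, ← Real.rpow_mul (by positivity),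
            one_div_mul_cancel (by linarith), Real.rpow_one]
      _ ≤ S ^ p := Real.rpow_le_rpow (by positivity) h1 (by linarith)
  have hmom := lintegral_abs_rpow_le hf ha hb hp hq1 hS0 hSq htail
  have hs0 : ENNReal.ofReal s ≠ 0 := by simpa using by linarith
  rw [eLpNorm_eq_lintegral_rpow_enorm_toReal hs0 ENNReal.ofReal_ne_top,
    ENNReal.toReal_ofReal (by linarith)]
  have hpt : ∀ x, ‖(15 / R * f x) ^ (2 * N)‖ₑ ^ s =
      ENNReal.ofReal ((15 / R) ^ q) * ENNReal.ofReal (|f x| ^ q) := by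
    intro x
    rw [← ENNReal.ofReal_mul (by positivity), ← Real.mul_rpow (by positivity) (abs_nonneg _),
      Real.enorm_eq_ofReal_abs, ENNReal.ofReal_rpow_of_nonneg (abs_nonneg _) (by linarith),
      abs_pow, abs_mul, abs_of_pos (by positivity : 0 < 15 / R), ← Real.rpow_natCast,
      ← Real.rpow_mul (by positivity)]
    push_cast
    rfl
  simp_rw [hpt]
  rw [lintegral_const_mul' _ _ ENNReal.ofReal_ne_top]
  have hfin : (15 / R) ^ q * ((1 + a * q) * S ^ q) ≤ (1 / N : ℝ) ^ s := by
    have h1 : 1 + a * q ≤ (2 * (1 + a)) ^ q := by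
      have h2 : 1 + q ≤ 2 ^ q := by
        have := one_add_mul_self_le_rpow_one_add (s := 1) (by norm_num) hq1
        norm_num at this
        linarith
      rw [Real.mul_rpow (by norm_num) (by positivity)]
      have h3 : 1 + a ≤ (1 + a) ^ q := Real.self_le_rpow_of_one_le (by linarith) hq1
      calc 1 + a * q ≤ (1 + q) * (1 + a) := by nlinarith
        _ ≤ _ := by gcongr
    calc (15 / R) ^ q * ((1 + a * q) * S ^ q)
        ≤ (15 / R) ^ q * ((2 * (1 + a)) ^ q * S ^ q) := by gcongr
      _ = (1 / 4) ^ q := by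
          rw [← Real.mul_rpow (by positivity) (by positivity),
            ← Real.mul_rpow (by positivity) (by positivity), hS]
          congr 1
          field_simp
          norm_num
      _ = ((1 / 4) ^ (2 * N : ℝ)) ^ s := by rw [hq, Real.rpow_mul (by norm_num)]
      _ ≤ (1 / N : ℝ) ^ s := by
          refine Real.rpow_le_rpow (by positivity) ?_ (by linarith)
          rw [one_div, one_div, Real.inv_rpow (by norm_num)]
          gcongr
          have := one_add_mul_self_le_rpow_one_add (s := 3) (by norm_num)
            (by linarith : 1 ≤ (2 * N : ℝ))
          norm_num at this
          linarith
  calc _ ≤ (ENNReal.ofReal ((15 / R) ^ q) * ENNReal.ofReal ((1 + a * q) * S ^ q)) ^ (1 / s) := by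
        gcongr
    _ ≤ (ENNReal.ofReal ((1 / N : ℝ) ^ s)) ^ (1 / s) := by
        rw [← ENNReal.ofReal_mul (by positivity)]
        gcongr
    _ = ENNReal.ofReal (1 / N) := by
        rw [ENNReal.ofReal_rpow_of_nonneg (by positivity) (by positivity),
          ← Real.rpow_mul (by positivity), mul_one_div_cancel (by linarith), Real.rpow_one]

/-! ### The `L^s` norm of the gap -/

/-- The `L^s` bound for a function that is at most `2` on a set `B` with `2 * μ B ≤ (ε / 2) ^ s`.
The factor `2⁻¹ ^ (1 / s) ≤ 1 - 1 / (2 * s)` leaves room `ε / (2 * s)` for the small terms. -/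
lemma eLpNorm_le_of_le_indicator_add {Ω ι : Type*} [MeasurableSpace Ω] [Fintype ι] {μ : Measure Ω}
    [IsProbabilityMeasure μ] {B : Set Ω} (hB : MeasurableSet B) {ε s c ν : ℝ} (hε : 0 < ε)
    (hs : 1 ≤ s) (hBμ : μ B ≤ ENNReal.ofReal ((ε / 2) ^ s / 2)) {h : Ω → ℝ} {v : ι → Ω → ℝ}
    (hv : ∀ i, Measurable (v i))
    (hvν : ∀ i, eLpNorm (v i) (ENNReal.ofReal s) μ ≤ ENNReal.ofReal ν) (hc : 0 ≤ c) (hν : 0 ≤ ν)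
    (hh0 : ∀ x, 0 ≤ h x)
    (hh : ∀ x, h x ≤ B.indicator (fun _ => (2 : ℝ)) x + c + 4 * ∑ i, v i x)
    (hsmall : c + 4 * (Fintype.card ι * ν) ≤ ε / (2 * s)) :
    eLpNorm h (ENNReal.ofReal s) μ ≤ ENNReal.ofReal ε := by
  have hs0 : ENNReal.ofReal s ≠ 0 := by simpa using by linarith
  have hs1 : 1 ≤ ENNReal.ofReal s := by simpa using hs
  have hmono := eLpNorm_mono_real (p := ENNReal.ofReal s) (μ := μ)
    (f := h) (g := B.indicator (fun _ => (2 : ℝ)) + (fun _ => c) + (4 : ℝ) • ∑ i, v i) fun x => by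
      rw [Real.norm_of_nonneg (hh0 x)]
      simpa using hh x
  have hBm : AEStronglyMeasurable (B.indicator (fun _ => (2 : ℝ))) μ :=
    aestronglyMeasurable_const.indicator hB
  have hcm : AEStronglyMeasurable (fun _ : Ω => c) μ := aestronglyMeasurable_const
  have hvm : AEStronglyMeasurable (∑ i, v i) μ :=
    Finset.aestronglyMeasurable_sum _ fun i _ => (hv i).aestronglyMeasurable
  have h1 : eLpNorm (B.indicator (fun _ => (2 : ℝ))) (ENNReal.ofReal s) μ ≤
      ENNReal.ofReal (ε - ε / (2 * s)) := by
    refine (eLpNorm_indicator_const_le _ _).trans ?_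
    rw [ENNReal.toReal_ofReal (by linarith), Real.enorm_eq_ofReal (by norm_num)]
    calc _ ≤ ENNReal.ofReal 2 * ENNReal.ofReal ((ε / 2) ^ s / 2) ^ (1 / s) := by gcongr
      _ = ENNReal.ofReal (2 * ((ε / 2) ^ s * (1 / 2)) ^ (1 / s)) := by
          rw [ENNReal.ofReal_rpow_of_nonneg (by positivity) (by positivity),
            ← ENNReal.ofReal_mul (by norm_num)]
          ring_nf
      _ ≤ ENNReal.ofReal (ε - ε / (2 * s)) := by
          refine ENNReal.ofReal_le_ofReal ?_
          rw [Real.mul_rpow (by positivity) (by positivity), ← Real.rpow_mul (by positivity),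
            mul_one_div_cancel (by linarith), Real.rpow_one]
          have h2 := rpow_one_add_le_one_add_mul_self (s := -(1 / 2)) (by norm_num)
            (by positivity : 0 ≤ 1 / s) (by rw [div_le_one (by linarith)]; exact hs)
          have e : 1 + -(1 / 2 : ℝ) = 1 / 2 := by norm_num
          rw [e] at h2
          calc 2 * (ε / 2 * (1 / 2) ^ (1 / s)) ≤ 2 * (ε / 2 * (1 + 1 / s * -(1 / 2))) := by gcongr
            _ = ε - ε / (2 * s) := by field_simp; ring
  have h2 : eLpNorm (fun _ : Ω => c) (ENNReal.ofReal s) μ ≤ ENNReal.ofReal c := by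
    rw [eLpNorm_const c hs0 (IsProbabilityMeasure.ne_zero μ), measure_univ, ENNReal.one_rpow,
      mul_one, Real.enorm_eq_ofReal hc]
  have h3 : eLpNorm ((4 : ℝ) • ∑ i, v i) (ENNReal.ofReal s) μ ≤
      ENNReal.ofReal (4 * (Fintype.card ι * ν)) := by
    rw [eLpNorm_const_smul, ENNReal.ofReal_mul (by norm_num), Real.enorm_eq_ofReal (by norm_num)]
    gcongr
    refine (eLpNorm_sum_le (fun i _ => (hv i).aestronglyMeasurable) hs1).trans ?_
    refine (Finset.sum_le_sum fun i _ => hvν i).trans ?_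
    simp [ENNReal.ofReal_mul]
  have hpos : 0 ≤ ε - ε / (2 * s) := by
    rw [sub_nonneg, div_le_iff₀ (by positivity)]
    nlinarith
  calc eLpNorm h (ENNReal.ofReal s) μ ≤ _ := hmono
    _ ≤ eLpNorm (B.indicator (fun _ => (2 : ℝ)) + (fun _ => c)) (ENNReal.ofReal s) μ +
        eLpNorm ((4 : ℝ) • ∑ i, v i) (ENNReal.ofReal s) μ :=
        eLpNorm_add_le (hBm.add hcm) (hvm.const_smul _) hs1
    _ ≤ (ENNReal.ofReal (ε - ε / (2 * s)) + ENNReal.ofReal c) +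
        ENNReal.ofReal (4 * (Fintype.card ι * ν)) :=
        add_le_add ((eLpNorm_add_le hBm hcm hs1).trans (add_le_add h1 h2)) h3
    _ ≤ ENNReal.ofReal ε := by
        rw [← ENNReal.ofReal_add hpos hc, ← ENNReal.ofReal_add (by positivity) (by positivity)]
        exact ENNReal.ofReal_le_ofReal (by linarith)

/-! ### Sandwiching polynomials from suitable parameters -/

/-- The sandwiching degree is at most `2 * N` as soon as the parameters fit: `N` is the degree of
the polynomials on the cube of radius `R`, `ρ` the width of the transition and `η` its error. -/
theorem hasSandwichingPolynomials_of_parameters {d k j N : ℕ}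
    {D : Measure (EuclideanSpace ℝ (Fin d))} [IsProbabilityMeasure D] {γ a b κ ε s R ρ η : ℝ}
    (hγ : 0 < γ) (ha : 0 < a) (hb : 0 < b) (hε : 0 < ε) (hs : 1 ≤ s)
    (hsub : IsStrictlySubexponential D γ a b) (hanti : IsAnticoncentrated D κ)
    {f : BooleanConcept d} (hf : f ∈ functionsOfHalfspaces d k) (hj : 1 ≤ j) (hN1 : 1 ≤ N)
    (hρ : 0 < ρ) (hρR : ρ ≤ R) (hη0 : 0 ≤ η)
    (hη : 6 / ((4 * j + 1) * (ρ / (8 * R))) ^ 3 ≤ η) (hN : k * (16 * j + 5) ≤ N)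
    (hR : 480 * (1 + a) * (1 + 1 / b) * s * (N : ℝ) ^ (1 / (1 + γ)) ≤ R)
    (hρε : k * (κ * ρ) ≤ (ε / 2) ^ s / 2)
    (hsmall : 6 * (k * η) + 4 * (k * (1 / N : ℝ)) ≤ ε / (2 * s)) :
    HasSandwichingPolynomials f D ε s (2 * N) := by
  obtain ⟨w, t, G, hw, hfG⟩ := hf
  obtain ⟨pUp, pDown, hUp, hDown, hp⟩ :=
    exists_pointwise_sandwich w t G hj (hρ.trans_le hρR) hρ hρR hη hN
  refine ⟨pUp, pDown, hUp, hDown, fun x => ?_, ?_⟩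
  · rw [hfG x]
    exact ⟨(hp x).1, (hp x).2.1⟩
  have hBm : MeasurableSet (⋃ i, {x | |inner ℝ (w i) x - t i| ≤ ρ}) :=
    MeasurableSet.iUnion fun i => measurableSet_le (by fun_prop) measurable_const
  refine eLpNorm_le_of_le_indicator_add hBm hε hs ?_
    (v := fun i x => (15 / R * inner ℝ (w i) x) ^ (2 * N)) (ν := 1 / N) (fun i => by fun_prop)
    (fun i => ?_) (by positivity : 0 ≤ 6 * (k * η)) (by positivity) (fun x => ?_)
    (fun x => (hp x).2.2) (by simpa using hsmall)
  · calc _ ≤ ∑ i, D {x | |inner ℝ (w i) x - t i| ≤ ρ} := measure_iUnion_fintype_le _ _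
      _ ≤ ∑ _i : Fin k, ENNReal.ofReal (κ * ρ) :=
          Finset.sum_le_sum fun i _ => hanti (w i) (hw i) (t i) ρ hρ.le
      _ = ENNReal.ofReal (k * (κ * ρ)) := by
          simp [ENNReal.ofReal_mul]
      _ ≤ _ := ENNReal.ofReal_le_ofReal hρε
  · exact eLpNorm_pow_le (by fun_prop) ha hb (by linarith) hs hN1 hR (hsub (w i) (hw i))
  · linarith [(hp x).1, (hp x).2.1]

/-! ### The rate and the choice of parameters -/

lemma halfspaceRate_eq {k : ℕ} {ε s : ℝ} (hε : 0 < ε) :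
    halfspaceRate k ε s = (k : ℝ) ^ (5 / 2 : ℝ) * s * (2 / ε) ^ (s + 1) := by
  rw [halfspaceRate, div_eq_mul_inv, ← Real.inv_rpow (by positivity), inv_div]

lemma two_div_rpow_le_halfspaceRate {k : ℕ} (hk : 1 ≤ k) {ε s : ℝ} (hε : 0 < ε) (hs : 1 ≤ s) :
    k * s * (2 / ε) ^ (s + 1) ≤ halfspaceRate k ε s := by
  have hk' : (1 : ℝ) ≤ k := by exact_mod_cast hk
  rw [halfspaceRate_eq hε]
  gcongr
  exact Real.self_le_rpow_of_one_le hk' (by norm_num)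

lemma two_div_le_rpow {ε s : ℝ} (hε : 0 < ε) (hε1 : ε < 1) (hs : 1 ≤ s) :
    2 / ε ≤ (2 / ε) ^ (s + 1) :=
  Real.self_le_rpow_of_one_le (by rw [one_le_div hε]; linarith) (by linarith)

/-- The logarithm of the rate absorbs any power of `s`. -/
lemma le_log_halfspaceRate {k : ℕ} (hk : 1 ≤ k) {ε s : ℝ} (hε : 0 < ε) (hε1 : ε < 1)
    (hs : 1 ≤ s) :
    1 ≤ Real.log (halfspaceRate k ε s) ∧ s ≤ 2 * Real.log (halfspaceRate k ε s) := by
  have hk' : (1 : ℝ) ≤ k := by exact_mod_cast hk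
  have h2 : (2 : ℝ) ^ (s + 1) ≤ halfspaceRate k ε s := by
    refine le_trans ?_ (two_div_rpow_le_halfspaceRate hk hε hs)
    have h3 : (2 : ℝ) ^ (s + 1) ≤ (2 / ε) ^ (s + 1) := by
      gcongr
      rw [le_div_iff₀ hε]; linarith
    have : 1 ≤ k * s := by nlinarith
    nlinarith [Real.rpow_pos_of_pos (by positivity : 0 < 2 / ε) (s + 1)]
  have h3 := Real.log_le_log (by positivity) h2
  rw [Real.log_rpow (by norm_num)] at h3
  have := Real.log_two_gt_d9
  constructor <;> nlinarith

/-- The degree needed on a cube, in terms of the rate. -/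
lemma degree_le_halfspaceRate_mul_log {k : ℕ} (hk : 1 ≤ k) {ε s : ℝ} (hε : 0 < ε) (hε1 : ε < 1)
    (hs : 1 ≤ s) :
    (k : ℝ) ^ 2 * s * (2 / ε) ^ s * √(48 * k * s / ε) ≤
      14 * (halfspaceRate k ε s * Real.log (halfspaceRate k ε s)) := by
  have hk' : (1 : ℝ) ≤ k := by exact_mod_cast hk
  obtain ⟨-, hl⟩ := le_log_halfspaceRate hk hε hε1 hs
  have h0 : 0 ≤ 2 / ε := by positivity
  have hsq : √(48 * k * s / ε) ≤ 7 * √k * (s * (2 / ε)) := by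
    rw [Real.sqrt_le_left (by positivity)]
    have e : (7 * √(k : ℝ) * (s * (2 / ε))) ^ 2 = 49 * k * (s * (2 / ε)) ^ 2 := by
      rw [mul_pow, mul_pow, Real.sq_sqrt (by positivity)]; norm_num
    rw [e]
    have h1 : 1 ≤ 1 / ε := by rw [one_le_div hε]; exact hε1.le
    have e2 : 48 * k * s / ε = 48 * k * (s * (1 / ε)) := by ring
    have e3 : 49 * k * (s * (2 / ε)) ^ 2 = 49 * k * (4 * (s * (1 / ε)) ^ 2) := by ring
    rw [e2, e3]
    have h2 : 1 ≤ s * (1 / ε) := by nlinarith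
    have h3 : 48 * (s * (1 / ε)) ≤ 49 * (4 * (s * (1 / ε)) ^ 2) := by nlinarith
    nlinarith
  have hkk : (k : ℝ) ^ (5 / 2 : ℝ) = k ^ 2 * √k := by
    rw [Real.sqrt_eq_rpow, ← Real.rpow_natCast, ← Real.rpow_add (by positivity)]
    norm_num
  have hεs : (2 / ε) ^ (s + 1) = (2 / ε) ^ s * (2 / ε) := Real.rpow_add_one (by positivity) s
  have hX0 : 0 ≤ halfspaceRate k ε s := by
    rw [halfspaceRate]; positivity
  calc _ ≤ (k : ℝ) ^ 2 * s * (2 / ε) ^ s * (7 * √k * (s * (2 / ε))) := by gcongr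
    _ = 7 * (halfspaceRate k ε s * s) := by rw [halfspaceRate_eq hε, hkk, hεs]; ring
    _ ≤ 7 * (halfspaceRate k ε s * (2 * Real.log (halfspaceRate k ε s))) := by gcongr
    _ = _ := by ring

/-- The choice of the degree: `N` is about `Y ^ (1 + 1 / γ) / 2`, so that
`Y / 4 * N ^ (1 / (1 + γ)) ≤ N`. -/
lemma exists_degree {Y γ : ℝ} (hY : 4 ≤ Y) (hγ : 0 < γ) :
    ∃ N : ℕ, (2 * N : ℝ) ≤ Y ^ (1 + 1 / γ) ∧ Y / 4 ≤ N ∧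
      Y / 4 * (N : ℝ) ^ (1 / (1 + γ)) ≤ N := by
  have hγ' : 0 < 1 / γ := by positivity
  have hYe : Y ≤ Y ^ (1 + 1 / γ) := Real.self_le_rpow_of_one_le (by linarith) (by linarith)
  refine ⟨⌊Y ^ (1 + 1 / γ) / 2⌋₊, ?_, ?_⟩
  · have := Nat.floor_le (by positivity : 0 ≤ Y ^ (1 + 1 / γ) / 2)
    linarith
  have hlow : (Y / 4) ^ (1 + 1 / γ) ≤ (⌊Y ^ (1 + 1 / γ) / 2⌋₊ : ℝ) := by
    have h1 := Nat.lt_floor_add_one (Y ^ (1 + 1 / γ) / 2)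
    have h2 : (Y / 4) ^ (1 + 1 / γ) ≤ Y ^ (1 + 1 / γ) / 4 := by
      rw [Real.div_rpow (by linarith) (by norm_num)]
      gcongr
      exact Real.self_le_rpow_of_one_le (by norm_num) (by linarith)
    linarith
  set N : ℝ := (⌊Y ^ (1 + 1 / γ) / 2⌋₊ : ℝ)
  have h3 : Y / 4 ≤ N :=
    (Real.self_le_rpow_of_one_le (by linarith) (by linarith)).trans hlow
  have hN0 : 0 < N := by linarith
  refine ⟨h3, ?_⟩
  have h4 : Y / 4 ≤ N ^ (γ / (1 + γ)) := by
    calc Y / 4 = ((Y / 4) ^ (1 + 1 / γ)) ^ (γ / (1 + γ)) := by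
          rw [← Real.rpow_mul (by linarith)]
          have : (1 + 1 / γ) * (γ / (1 + γ)) = 1 := by field_simp; ring
          rw [this, Real.rpow_one]
      _ ≤ N ^ (γ / (1 + γ)) := by gcongr
  calc Y / 4 * N ^ (1 / (1 + γ)) ≤ N ^ (γ / (1 + γ)) * N ^ (1 / (1 + γ)) := by gcongr
    _ = N := by
        rw [← Real.rpow_add hN0]
        have : γ / (1 + γ) + 1 / (1 + γ) = 1 := by field_simp; ring
        rw [this, Real.rpow_one]

/-- The choice of the kernel degree for a transition of relative width `δ` and error `η`. -/
lemma exists_kernel_degree {δ η : ℝ} (hδ0 : 0 < δ) (hδ1 : δ ≤ 1) (hη0 : 0 < η) (hη1 : η ≤ 1) :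
    ∃ j : ℕ, 1 ≤ j ∧ 6 / ((4 * j + 1) * δ) ^ 3 ≤ η ∧ (16 * j + 5 : ℝ) ≤ 42 * (√(1 / η) / δ) := by
  set z := √(1 / η) / δ with hz
  have hsqrt : 1 ≤ √(1 / η) := by
    rw [Real.one_le_sqrt, one_le_div hη0]
    exact hη1
  have hz1 : 1 ≤ z := by
    rw [hz, le_div_iff₀ hδ0]; linarith
  have hzj : z ≤ ⌈z⌉₊ := Nat.le_ceil z
  have hj2 : (⌈z⌉₊ : ℝ) ≤ 2 * z := by
    have := Nat.ceil_lt_add_one (by linarith : 0 ≤ z)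
    linarith
  have hj1 : (1 : ℝ) ≤ ⌈z⌉₊ := hz1.trans hzj
  refine ⟨⌈z⌉₊, by exact_mod_cast hj1, ?_, by linarith⟩
  have hx : 4 * √(1 / η) ≤ (4 * ⌈z⌉₊ + 1) * δ := by
    have h1 : z * δ = √(1 / η) := by rw [hz]; field_simp
    nlinarith
  have hx1 : 1 ≤ (4 * ⌈z⌉₊ + 1) * δ := by linarith
  have hx2 : 6 / η ≤ ((4 * ⌈z⌉₊ + 1) * δ) ^ 2 := by
    have h2 := pow_le_pow_left₀ (by positivity) hx 2
    rw [mul_pow, Real.sq_sqrt (by positivity)] at h2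
    have h3 : 0 < 1 / η := by positivity
    have e : 6 / η = 6 * (1 / η) := by ring
    linarith
  have hx3 : 6 / η ≤ ((4 * ⌈z⌉₊ + 1) * δ) ^ 3 :=
    hx2.trans (pow_le_pow_right₀ hx1 (by norm_num))
  rw [div_le_iff₀ (by positivity)]
  rw [div_le_iff₀ hη0] at hx3
  linarith

lemma small_terms_le {k s ε N : ℝ} (hk : 1 ≤ k) (hs : 1 ≤ s) (hε : 0 < ε)
    (hN : 32 * (k * s * (2 / ε)) ≤ N) :
    6 * (k * (ε / (48 * k * s))) + 4 * (k * (1 / N)) ≤ ε / (2 * s) := by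
  have hN0 : 0 < N := lt_of_lt_of_le (by positivity) hN
  have e1 : 6 * (k * (ε / (48 * k * s))) = ε / (8 * s) := by field_simp; norm_num
  have e2 : 4 * (k * (1 / N)) ≤ ε / (8 * s) := by
    have h1 : 32 * (k * s * (2 / ε)) * ε ≤ N * ε := by gcongr
    have h2 : 32 * (k * s * (2 / ε)) * ε = 64 * (k * s) := by field_simp; norm_num
    have h3 : 0 < k * s := by positivity
    rw [le_div_iff₀ (by positivity)]
    have e3 : 4 * (k * (1 / N)) * (8 * s) = 32 * (k * s) / N := by ring
    rw [e3, div_le_iff₀ hN0]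
    linarith
  have e4 : ε / (2 * s) = 4 * (ε / (8 * s)) := by field_simp; norm_num
  have : 0 < ε / (8 * s) := by positivity
  linarith

/-- The sandwiching polynomials for the parameters `ρ`, `η`, `R` chosen in terms of the degree `N`.
The constant `37632 = 4 * 14 * 672` collects the `4` of `exists_degree`, the `14` of
`degree_le_halfspaceRate_mul_log` and `672 = 42 * 8 * 2` from the kernel degree. -/
theorem exists_hasSandwichingPolynomials {a b κ : ℝ} (ha : 0 < a) (hb : 0 < b) (hκ : 0 < κ)
    {γ : ℝ} {d k : ℕ} {D : Measure (EuclideanSpace ℝ (Fin d))} [IsProbabilityMeasure D] {ε s : ℝ}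
    (hγ : 0 < γ) (hsub : IsStrictlySubexponential D γ a b) (hanti : IsAnticoncentrated D κ)
    (hε : 0 < ε) (hε1 : ε < 1) (hs : 1 ≤ s) (hk : 1 ≤ k) :
    ∃ N : ℕ, (2 * N : ℝ) ≤ (37632 * (1 + κ) * (480 * (1 + a) * (1 + 1 / b)) *
        (halfspaceRate k ε s * Real.log (halfspaceRate k ε s))) ^ (1 + 1 / γ) ∧
      ∀ f ∈ functionsOfHalfspaces d k, HasSandwichingPolynomials f D ε s (2 * N) := by
  have hk' : (1 : ℝ) ≤ k := by exact_mod_cast hk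
  set A := 480 * (1 + a) * (1 + 1 / b) with hA
  have hA1 : 480 ≤ A := by
    have : 0 < 1 / b := by positivity
    have : 1 ≤ (1 + a) * (1 + 1 / b) := by nlinarith
    rw [hA]; linarith
  set L := halfspaceRate k ε s * Real.log (halfspaceRate k ε s) with hL
  obtain ⟨hl1, -⟩ := le_log_halfspaceRate hk hε hε1 hs
  have hε2 := two_div_le_rpow hε hε1 hs
  have hXks : k * s * (2 / ε) ≤ halfspaceRate k ε s :=
    le_trans (by gcongr) (two_div_rpow_le_halfspaceRate hk hε hs)
  have hks : 1 ≤ k * s := by nlinarith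
  have h2ε : 2 ≤ 2 / ε := by rw [le_div_iff₀ hε]; linarith
  have hLks : k * s * (2 / ε) ≤ L := by
    refine hXks.trans (le_mul_of_one_le_right ?_ hl1)
    rw [halfspaceRate]
    positivity
  have hL1 : 1 ≤ L := by nlinarith
  have hC : 480 ≤ (1 + κ) * A := by nlinarith
  have hCL : 480 * L ≤ (1 + κ) * A * L := by gcongr
  obtain ⟨N, hN2, hNY, hNp⟩ := exists_degree (Y := 37632 * (1 + κ) * A * L) (γ := γ)
    (by linarith) hγ
  refine ⟨N, hN2, fun f hf => ?_⟩
  have hNL : 32 * L ≤ N := by linarith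
  have hNr : (1 : ℝ) ≤ N := by linarith
  have hN1 : 1 ≤ N := by exact_mod_cast hNr
  have hNpow : 1 ≤ (N : ℝ) ^ (1 / (1 + γ)) := Real.one_le_rpow hNr (by positivity)
  set R := A * s * (N : ℝ) ^ (1 / (1 + γ)) with hR
  have hR1 : 1 ≤ R := by
    have : 1 ≤ A * s := by nlinarith
    nlinarith
  set ρ := (ε / 2) ^ s / (2 * k * (1 + κ)) with hρ
  have hρ0 : 0 < ρ := by positivity
  have hρ1 : ρ ≤ 1 := by
    rw [hρ, div_le_one (by positivity)]
    have h1 : (ε / 2) ^ s ≤ 1 := Real.rpow_le_one (by positivity) (by linarith) (by linarith)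
    nlinarith
  set η := ε / (48 * k * s) with hη
  have hη0 : 0 < η := by positivity
  have hη1 : η ≤ 1 := by
    rw [hη, div_le_one (by positivity)]
    nlinarith
  have hδ1 : ρ / (8 * R) ≤ 1 := by
    rw [div_le_one (by positivity)]; linarith
  have hδ0 : 0 < ρ / (8 * R) := by positivity
  obtain ⟨j, hj1, hjη, hj⟩ := exists_kernel_degree hδ0 hδ1 hη0 hη1
  refine hasSandwichingPolynomials_of_parameters (j := j) (R := R) (ρ := ρ) (η := η) hγ ha hb hε hs
    hsub hanti hf hj1 hN1 hρ0 (hρ1.trans hR1) hη0.le hjη ?_ le_rfl ?_ ?_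
  · have hz : √(1 / η) / (ρ / (8 * R)) =
        8 * R * (2 * k * (1 + κ)) * (2 / ε) ^ s * √(48 * k * s / ε) := by
      have e1 : (2 / ε) ^ s = ((ε / 2) ^ s)⁻¹ := by
        rw [← Real.inv_rpow (by positivity), inv_div]
      rw [hρ, hη, e1, one_div_div, div_div_eq_mul_div, div_div_eq_mul_div]
      ring
    have hdeg := degree_le_halfspaceRate_mul_log hk hε hε1 hs
    have hfin : (k : ℝ) * (16 * j + 5) ≤ N := by
      calc (k : ℝ) * (16 * j + 5) ≤ k * (42 * (√(1 / η) / (ρ / (8 * R)))) := by gcongr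
        _ = 672 * (1 + κ) * A * (N : ℝ) ^ (1 / (1 + γ)) *
            ((k : ℝ) ^ 2 * s * (2 / ε) ^ s * √(48 * k * s / ε)) := by
            rw [hz, hR]; ring
        _ ≤ 672 * (1 + κ) * A * (N : ℝ) ^ (1 / (1 + γ)) * (14 * L) := by gcongr
        _ = 37632 * (1 + κ) * A * L / 4 * (N : ℝ) ^ (1 / (1 + γ)) := by ring
        _ ≤ N := hNp
    exact_mod_cast hfin
  · have e : k * (κ * ρ) = (ε / 2) ^ s / 2 * (κ / (1 + κ)) := by
      rw [hρ]; field_simp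
    rw [e]
    refine mul_le_of_le_one_right (by positivity) ?_
    rw [div_le_one (by positivity)]
    linarith
  · exact small_terms_le hk' hs hε (by linarith)

/-! ### The sandwiching degree of the class -/

lemma hasSandwichingPolynomials_zero_of_const {d : ℕ} {f : BooleanConcept d} {u : ℤˣ}
    (hf : ∀ x, f x = u) (D : Measure (EuclideanSpace ℝ (Fin d))) (ε s : ℝ) :
    HasSandwichingPolynomials f D ε s 0 := by
  refine ⟨MvPolynomial.C ((u : ℤ) : ℝ), MvPolynomial.C ((u : ℤ) : ℝ),
    (MvPolynomial.totalDegree_C _).le, (MvPolynomial.totalDegree_C _).le, fun x => ?_, ?_⟩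
  · simp only [MvPolynomial.eval_C, hf]
    exact ⟨le_rfl, le_rfl⟩
  · simp

lemma classSandwichingDegree_le {d : ℕ} {F : Set (BooleanConcept d)}
    {D : Measure (EuclideanSpace ℝ (Fin d))} {ε s T : ℝ} {n : ℕ} (hn : (n : ℝ) ≤ T)
    (h : ∀ f ∈ F, HasSandwichingPolynomials f D ε s n) :
    ((classSandwichingDegree F D ε s : ℕ∞) : ℝ≥0∞) ≤ ENNReal.ofReal T := by
  have h1 : classSandwichingDegree F D ε s ≤ n :=
    iSup₂_le fun f hf => iInf₂_le n (h f hf)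
  calc _ ≤ (((n : ℕ∞)) : ℝ≥0∞) := ENat.toENNReal_le.2 h1
    _ = ENNReal.ofReal n := by simp
    _ ≤ ENNReal.ofReal T := ENNReal.ofReal_le_ofReal hn

theorem theorem4p2 :
    ∃ c : ℕ, ∀ a b κ : ℝ, 0 < a → 0 < b → 0 < κ →
      ∃ C : ℝ, 0 < C ∧
        ∀ (γ : ℝ) (d k : ℕ) (D : Measure (EuclideanSpace ℝ (Fin d))) (ε s : ℝ),
          0 < γ → IsProbabilityMeasure D →
          IsStrictlySubexponential D γ a b → IsAnticoncentrated D κ →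
          0 < ε → ε < 1 → 1 ≤ s →
          ((classSandwichingDegree (functionsOfHalfspaces d k) D ε s : ℕ∞) : ℝ≥0∞) ≤
            ENNReal.ofReal
              ((C * (halfspaceRate k ε s * Real.log (halfspaceRate k ε s) ^ c)) ^
                (1 + 1 / γ)) := by
  refine ⟨1, fun a b κ ha hb hκ => ⟨37632 * (1 + κ) * (480 * (1 + a) * (1 + 1 / b)), by positivity,
    fun γ d k D ε s hγ hD hsub hanti hε hε1 hs => ?_⟩⟩
  rw [pow_one]
  rcases Nat.eq_zero_or_pos k with rfl | hk
  · refine classSandwichingDegree_le (n := 0) ?_ fun f hf => ?_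
    · have : halfspaceRate 0 ε s = 0 := by simp [halfspaceRate]
      rw [this, zero_mul, mul_zero, Nat.cast_zero]
      exact Real.rpow_nonneg le_rfl _
    · obtain ⟨w, t, G, -, hG⟩ := hf
      exact hasSandwichingPolynomials_zero_of_const
        (fun x => (hG x).trans (congrArg G (Subsingleton.elim _ finZeroElim))) D ε s
  · obtain ⟨N, hN, h⟩ := exists_hasSandwichingPolynomials ha hb hκ hγ hsub hanti hε hε1 hs hk
    exact classSandwichingDegree_le (n := 2 * N) (by exact_mod_cast hN) h
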